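/- Let $\theta\in(0,\pi/2)$. For $n>1$, let $W_\theta=(W_\theta(1),W_\theta(2),\dots)$ denote a (time-homogeneous) Markov chain with values in the unit sphere $\mathbb S^{n-1}\subset\mathbb R^n$, with arbitrary initial distribution, such that for every $i\ge 1$ and $u\in\mathbb S^{n-1}$ the distribution of $W_\theta(i+1)$ conditioned on $W_\theta(i)=u$ is uniform on the $(n-2)$-sphere $\mathbb S^{n-1}\cap\{x\in\mathbb R^n:\langle x,u\rangle=\cos\theta\}$. For $\varphi\in(0,\pi/2]$, a set $A\subset\mathbb S^{n-1}$ is called a $\varphi$-covering of $\mathbb S^{n-1}$ if the geodesic distance from any point of $\mathbb S^{n-1}$ to $A$ is at most $\varphi$, and the $\varphi$-covering time of $W_\theta$ is the random variable $$T_\varphi=\min\{N:\ \{W_\theta(i):\,i\le N\}\text{ is a }\varphi\text{-covering of }\mathbb S^{n-1}\}\in\mathbb N\cup\{\infty\}.$$ Theorem. For every $\theta\in(0,\pi/2)$ there exist $L=L(\theta)$ and $n_0=n_0(\theta)$, depending only on $\theta$, such that for every $n\ge n_0$, every walk $W_\theta$ on $\mathbb S^{n-1}$ as above and every natural number $N\ge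 Ln$, $$\mathbb P\bigl\{0\in\mathrm{conv}\{W_\theta(i):\,i\le N\}\bigr\}\ge 1-\exp(-n).$$ Equivalently, the $\pi/2$-covering time of the walk is $O(n)$: for all $n\ge n_0$ and $N\ge Ln$ one has $\mathbb P\{T_{\pi/2}\le N\}\ge 1-\exp(-n)$. Moreover, for all $n\ge n_0$ and $N\in\mathbb N$, the events $\{0\in\mathrm{conv}\{W_\theta(i):\,i\le N\}\}$ and $\{T_{\pi/2}\le N\}$ coincide. -/

import Mathlib

open MeasureTheory

/-- The unit sphere `S^{n-1}` of `ℝⁿ`. -/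
abbrev UnitSphere (n : ℕ) : Type :=
  Metric.sphere (0 : EuclideanSpace ℝ (Fin n)) 1

/-- The uniform probability measure on the unit sphere of a nontrivial finite-dimensional real inner
product space: the normalized surface measure. On a one-dimensional space, whose unit sphere has
two points, it gives mass `1/2` to each of them. -/
noncomputable def uniformSphere (E : Type*) [NormedAddCommGroup E] [InnerProductSpace ℝ E]
    [FiniteDimensional ℝ E] [MeasurableSpace E] [BorelSpace E] :
    Measure (Metric.sphere (0 : E) 1) :=
  ((volume : Measure E).toSphere Set.univ)⁻¹ • (volume : Measure E).toSphere

theorem sphereStep_mem {n : ℕ} (θ : ℝ) (u : UnitSphere n)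
    (v : Metric.sphere (0 : ((Submodule.span ℝ {(u : EuclideanSpace ℝ (Fin n))})ᗮ :
      Submodule ℝ (EuclideanSpace ℝ (Fin n)))) 1) :
    Real.cos θ • (u : EuclideanSpace ℝ (Fin n)) +
        Real.sin θ • ((v : ((Submodule.span ℝ {(u : EuclideanSpace ℝ (Fin n))})ᗮ :
          Submodule ℝ (EuclideanSpace ℝ (Fin n)))) : EuclideanSpace ℝ (Fin n)) ∈
      Metric.sphere (0 : EuclideanSpace ℝ (Fin n)) 1 := by
  have hu : ‖(u : EuclideanSpace ℝ (Fin n))‖ = 1 := norm_eq_of_mem_sphere u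
  have hv : ‖((v : ((Submodule.span ℝ {(u : EuclideanSpace ℝ (Fin n))})ᗮ :
      Submodule ℝ (EuclideanSpace ℝ (Fin n)))) : EuclideanSpace ℝ (Fin n))‖ = 1 :=
    norm_eq_of_mem_sphere v
  have huv := Submodule.mem_orthogonal_singleton_iff_inner_right.1 v.1.2
  rw [mem_sphere_zero_iff_norm, ← sq_eq_sq₀ (norm_nonneg _) zero_le_one, norm_add_sq_real,
    norm_smul, norm_smul, inner_smul_left, inner_smul_right, hu, hv, huv]
  simp

/-- The point of `S^{n-1}` reached from `u` by moving by the angle `θ` in the direction of the unit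
vector `v` orthogonal to `u`. As `v` runs through the unit sphere of the hyperplane `uᗮ`, this
parametrizes the sphere `{x ∈ S^{n-1} : ⟪x, u⟫ = cos θ}` (of centre `cos θ • u` and radius
`sin θ`) by a similarity. -/
noncomputable def sphereStep {n : ℕ} (θ : ℝ) (u : UnitSphere n)
    (v : Metric.sphere (0 : ((Submodule.span ℝ {(u : EuclideanSpace ℝ (Fin n))})ᗮ :
      Submodule ℝ (EuclideanSpace ℝ (Fin n)))) 1) : UnitSphere n :=
  ⟨Real.cos θ • (u : EuclideanSpace ℝ (Fin n)) +
    Real.sin θ • ((v : ((Submodule.span ℝ {(u : EuclideanSpace ℝ (Fin n))})ᗮ :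
      Submodule ℝ (EuclideanSpace ℝ (Fin n)))) : EuclideanSpace ℝ (Fin n)), sphereStep_mem θ u v⟩

/-- The uniform distribution on the `(n-2)`-sphere `{x ∈ S^{n-1} : ⟪x, u⟫ = cos θ}`. -/
noncomputable def stepLaw {n : ℕ} (θ : ℝ) (u : UnitSphere n) : Measure (UnitSphere n) :=
  (uniformSphere ((Submodule.span ℝ {(u : EuclideanSpace ℝ (Fin n))})ᗮ :
    Submodule ℝ (EuclideanSpace ℝ (Fin n)))).map (sphereStep θ u)

/-- `W 0, W 1, …` is a time-homogeneous Markov chain with transition probabilities `Q` and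
arbitrary initial distribution: given `W 0, …, W i`, the conditional distribution of `W (i + 1)`
is `Q (W i)`. -/
structure IsMarkovChain {S Ω : Type*} [MeasurableSpace S] [MeasurableSpace Ω]
    (Q : S → Measure S) (W : ℕ → Ω → S) (P : Measure Ω) : Prop where
  measurable : ∀ i, Measurable (W i)
  condProb : ∀ (i : ℕ) (B : Set S), MeasurableSet B →
    P[(W (i + 1) ⁻¹' B).indicator (fun _ => (1 : ℝ)) |
        ⨆ j ∈ Set.Iic i, MeasurableSpace.comap (W j) inferInstance]
      =ᵐ[P] fun ω => (Q (W i ω)).real B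

/-- The walk `W_θ` on `S^{n-1}`; `W 0, W 1, …` are its first, second, … positions. -/
def IsSphereWalk {n : ℕ} {Ω : Type*} [MeasurableSpace Ω] (θ : ℝ) (W : ℕ → Ω → UnitSphere n)
    (P : Measure Ω) : Prop :=
  IsMarkovChain (stepLaw θ) W P

/-- `A` is a `φ`-covering of `S^{n-1}`: the geodesic distance from any point of the sphere to
the set `A` is at most `φ` (the distance to the empty set is `∞`). -/
def IsGeodesicCovering {n : ℕ} (φ : ℝ) (A : Set (UnitSphere n)) : Prop :=
  ∀ x : UnitSphere n,
    (⨅ y ∈ A, ENNReal.ofReal (InnerProductGeometry.angle (x : EuclideanSpace ℝ (Fin n))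
      (y : EuclideanSpace ℝ (Fin n)))) ≤ ENNReal.ofReal φ

/-- The `φ`-covering time: the least `N` such that the first `N` positions of the path `w` form
a `φ`-covering of the sphere (`∞` if there is none). -/
noncomputable def coveringTime {n : ℕ} (φ : ℝ) (w : ℕ → UnitSphere n) : ℕ∞ :=
  ⨅ (N : ℕ) (_ : IsGeodesicCovering φ (w '' {i | i < N})), (N : ℕ∞)

/-! Fix a unit vector `y` and follow the projections a_i = ⟪W i, y⟫. A step multiplies the
projection by cos θ and adds a fluctuation of order 1/√n, so the a_i² have average O(1/n), outside
an event of probability exponentially small in N (`IsSphereWalk.measureReal_sum_inner_sq_le`). Hence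
most times satisfy |a_i| ≤ K/√n, and from such a time the next projection falls below -1/√n with
probability at least p, uniformly in n (`exists_le_stepLaw`). So a fixed fraction of all times have
a_i < -1/√n, again up to exponentially small probability. Both deviation bounds are instances of one
exponential supermartingale inequality, `IsMarkovChain.measure_le_sum_le`.

The passage to all directions needs only a net of constant mesh ε. If 0 is not in the hull, some
unit `x` is positive on every point of the walk. For `y` in the net close to `x`, each time with a_i
< -1/√n gives ⟪W i, x - y⟫ > 1/√n, so Σ ⟪W i, x - y⟫² is at least a fixed multiple of N/n. But the
energy bound on the net extends to a bound for the whole quadratic form, making this sum O(ε² N/n),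
a contradiction for small ε (`exists_inner_nonpos_of_net`). As ε depends only on θ, the net has at
most Dⁿ points with D = D(θ), and a union bound succeeds as soon as N ≥ Ln. The covering-time form
follows by convex duality. -/

open ProbabilityTheory

/-! ### Gaussian measure and its radial projection to the sphere -/

section Gaussian

variable {E : Type*} [NormedAddCommGroup E] [InnerProductSpace ℝ E] [FiniteDimensional ℝ E]
  [MeasurableSpace E] [BorelSpace E]

/-- The density of the standard Gaussian measure as a function of the norm. -/
noncomputable def gaussianRadial (m : ℕ) (r : ℝ) : ENNReal :=
  ENNReal.ofReal ((2 * Real.pi) ^ (-(m : ℝ) / 2) * Real.exp (-(1 / 2) * r ^ 2))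

theorem measurable_gaussianRadial (m : ℕ) : Measurable (gaussianRadial m) := by
  unfold gaussianRadial; fun_prop

theorem integrable_exp_neg_mul_sq_norm {b : ℝ} (hb : 0 < b) :
    Integrable (fun x : E => Real.exp (-b * ‖x‖ ^ 2)) := by
  have h := (GaussianFourier.integrable_cexp_neg_mul_sq_norm_add
    (V := E) (b := (b : ℂ)) (by simpa using hb) 0 0).norm
  refine h.congr (Filter.Eventually.of_forall fun x => ?_)
  simp only [Complex.norm_exp]
  congr 1
  simp [← Complex.ofReal_pow]

theorem lintegral_exp_neg_mul_sq_norm {b : ℝ} (hb : 0 < b) :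
    ∫⁻ x : E, ENNReal.ofReal (Real.exp (-b * ‖x‖ ^ 2)) =
      ENNReal.ofReal ((Real.pi / b) ^ (Module.finrank ℝ E / 2 : ℝ)) := by
  rw [← ofReal_integral_eq_lintegral_ofReal (integrable_exp_neg_mul_sq_norm hb)
    (Filter.Eventually.of_forall fun x => (Real.exp_pos _).le),
    GaussianFourier.integral_rexp_neg_mul_sq_norm hb]

theorem lintegral_gaussianRadial_mul_exp {l : ℝ} (hl : -(1 / 2) < l) :
    ∫⁻ x : E, gaussianRadial (Module.finrank ℝ E) ‖x‖ * ENNReal.ofReal (Real.exp (-l * ‖x‖ ^ 2)) =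
      ENNReal.ofReal ((1 + 2 * l) ^ (-(Module.finrank ℝ E : ℝ) / 2)) := by
  have hb : 0 < 1 / 2 + l := by linarith
  have hpi := Real.pi_pos
  have h1 : ∀ x : E, gaussianRadial (Module.finrank ℝ E) ‖x‖ *
      ENNReal.ofReal (Real.exp (-l * ‖x‖ ^ 2)) =
      ENNReal.ofReal ((2 * Real.pi) ^ (-(Module.finrank ℝ E : ℝ) / 2)) *
        ENNReal.ofReal (Real.exp (-(1 / 2 + l) * ‖x‖ ^ 2)) := by
    intro x
    rw [gaussianRadial, ← ENNReal.ofReal_mul (by positivity), ← ENNReal.ofReal_mul (by positivity),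
      mul_assoc, ← Real.exp_add]
    congr 3
    ring
  simp_rw [h1]
  rw [lintegral_const_mul _ (by fun_prop), lintegral_exp_neg_mul_sq_norm hb,
    ← ENNReal.ofReal_mul (by positivity)]
  congr 1
  have h2 : Real.pi / (1 / 2 + l) = (2 * Real.pi) * (1 + 2 * l)⁻¹ := by
    have : 1 + 2 * l ≠ 0 := by linarith
    field_simp
  have h3 : (0 : ℝ) < 1 + 2 * l := by linarith
  rw [h2, Real.mul_rpow (x := 2 * Real.pi) (by positivity) (by positivity), ← mul_assoc,
    ← Real.rpow_add (by positivity), Real.inv_rpow h3.le, ← Real.rpow_neg h3.le]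
  simp [neg_div]

-- Both sides are finite measures with the same characteristic function. The explicit radial density
-- is what permits polar coordinates.
variable (E) in
theorem stdGaussian_eq_withDensity :
    stdGaussian E =
      (volume : Measure E).withDensity fun x => gaussianRadial (Module.finrank ℝ E) ‖x‖ := by
  have hfin : IsFiniteMeasure
      ((volume : Measure E).withDensity fun x => gaussianRadial (Module.finrank ℝ E) ‖x‖) := by
    refine isFiniteMeasure_withDensity ?_
    have := lintegral_gaussianRadial_mul_exp (E := E) (l := 0) (by norm_num)
    simp only [neg_zero, zero_mul, Real.exp_zero, ENNReal.ofReal_one, mul_one] at this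
    rw [this]
    exact ENNReal.ofReal_ne_top
  have hpi := Real.pi_pos
  refine Measure.ext_of_charFun (funext fun t => ?_)
  rw [charFun_stdGaussian, charFun_apply]
  unfold gaussianRadial
  rw [integral_withDensity_eq_integral_toReal_smul (by fun_prop)
    (Filter.Eventually.of_forall fun x => ENNReal.ofReal_lt_top)]
  have h1 : ∀ x : E, (ENNReal.ofReal ((2 * Real.pi) ^ (-(Module.finrank ℝ E : ℝ) / 2) *
      Real.exp (-(1 / 2) * ‖x‖ ^ 2))).toReal • Complex.exp (inner ℝ x t * Complex.I) =
      (((2 * Real.pi) ^ (-(Module.finrank ℝ E : ℝ) / 2) : ℝ) : ℂ) *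
        Complex.exp (-(1 / 2 : ℂ) * ‖x‖ ^ 2 + Complex.I * inner ℝ t x) := by
    intro x
    rw [ENNReal.toReal_ofReal (by positivity), Complex.real_smul, Complex.ofReal_mul, mul_assoc,
      Complex.ofReal_exp, ← Complex.exp_add, real_inner_comm]
    congr 2
    push_cast
    ring
  simp_rw [h1]
  rw [integral_const_mul, GaussianFourier.integral_cexp_neg_mul_sq_norm_add (by norm_num)]
  have h2 : ((Real.pi : ℂ) / (1 / 2)) = ((2 * Real.pi : ℝ) : ℂ) := by push_cast; ring
  have h3 : ((Module.finrank ℝ E : ℂ) / 2) = (((Module.finrank ℝ E : ℝ) / 2 : ℝ) : ℂ) := by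
    push_cast; ring
  rw [h2, h3, ← Complex.ofReal_cpow (by positivity), ← mul_assoc, ← Complex.ofReal_mul,
    ← Real.rpow_add (by positivity)]
  simp only [neg_div, neg_add_cancel, Real.rpow_zero, Complex.ofReal_one, one_mul]
  congr 1
  rw [Complex.I_sq]
  ring

theorem lintegral_stdGaussian (g : E → ENNReal) :
    ∫⁻ x, g x ∂stdGaussian E = ∫⁻ x, gaussianRadial (Module.finrank ℝ E) ‖x‖ * g x := by
  rw [stdGaussian_eq_withDensity]
  exact lintegral_withDensity_eq_lintegral_mul_non_measurable _
    ((measurable_gaussianRadial _).comp measurable_norm)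
    (Filter.Eventually.of_forall fun x => ENNReal.ofReal_lt_top) _

theorem lintegral_exp_sq_norm_stdGaussian {l : ℝ} (hl : -(1 / 2) < l) :
    ∫⁻ x, ENNReal.ofReal (Real.exp (-l * ‖x‖ ^ 2)) ∂stdGaussian E =
      ENNReal.ofReal ((1 + 2 * l) ^ (-(Module.finrank ℝ E : ℝ) / 2)) := by
  rw [lintegral_stdGaussian, lintegral_gaussianRadial_mul_exp hl]

theorem map_inner_stdGaussian {e : E} (he : ‖e‖ = 1) :
    (stdGaussian E).map (fun x => inner ℝ e x) = stdGaussian ℝ := by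
  have hm : Measurable (fun x : E => inner ℝ e x) := by fun_prop
  have : IsProbabilityMeasure ((stdGaussian E).map (fun x => inner ℝ e x)) :=
    Measure.isProbabilityMeasure_map hm.aemeasurable
  refine Measure.ext_of_charFun (funext fun t => ?_)
  rw [charFun_stdGaussian, charFun_apply, integral_map hm.aemeasurable (by fun_prop)]
  have h := charFun_stdGaussian (E := E) (t • e)
  rw [charFun_apply, norm_smul, he, mul_one] at h
  rw [← h]
  congr 1 with x
  congr 3
  simp [inner_smul_right, real_inner_comm]

/-- Polar coordinates for a product of a radial and an angular function. -/
theorem lintegral_radial_mul_angular {f : ℝ → ENNReal} (hf : Measurable f) {g : E → ENNReal}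
    (hg : Measurable g) [Nontrivial E] :
    ∫⁻ x : E, f ‖x‖ * g (‖x‖⁻¹ • x) =
      (∫⁻ r : Set.Ioi (0 : ℝ), f r ∂(Measure.volumeIoiPow (Module.finrank ℝ E - 1))) *
        ∫⁻ v, g v ∂(volume : Measure E).toSphere := by
  have h := (Measure.measurePreserving_homeomorphUnitSphereProd
    (volume : Measure E)).lintegral_comp (f := fun p => g (p.1 : E) * f p.2) (by fun_prop)
  rw [lintegral_prod_mul (f := fun v : Metric.sphere (0 : E) 1 => g v)
    (g := fun r : Set.Ioi (0 : ℝ) => f r) (by fun_prop) (by fun_prop)] at h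
  have h0 : ∫⁻ x : E, f ‖x‖ * g (‖x‖⁻¹ • x) =
      ∫⁻ x in ({0}ᶜ : Set E), f ‖x‖ * g (‖x‖⁻¹ • x) := by rw [restrict_compl_singleton]
  rw [mul_comm, ← h, h0, ← lintegral_subtype_comap (measurableSet_singleton _).compl]
  refine lintegral_congr fun x => ?_
  simp [mul_comm]

/-- In polar coordinates the Gaussian integral splits into a radial factor times a surface integral;
taking `g = 1` identifies the radial factor as the inverse of the total surface mass. All estimates
on the sphere are reduced to Gaussian ones in this way. -/
theorem lintegral_uniformSphere [Nontrivial E] {g : E → ENNReal} (hg : Measurable g) :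
    ∫⁻ v, g v ∂uniformSphere E = ∫⁻ x, g (‖x‖⁻¹ • x) ∂stdGaussian E := by
  have hm := measurable_gaussianRadial (Module.finrank ℝ E)
  have h1 := lintegral_radial_mul_angular hm hg
  have h2 := lintegral_radial_mul_angular (E := E) hm (g := fun _ => 1) measurable_const
  rw [← lintegral_stdGaussian] at h1 h2
  simp only [lintegral_const, measure_univ, one_mul] at h2
  set R := ∫⁻ r : Set.Ioi (0 : ℝ), gaussianRadial (Module.finrank ℝ E) r
    ∂(Measure.volumeIoiPow (Module.finrank ℝ E - 1))
  rw [h1, uniformSphere, lintegral_smul_measure, smul_eq_mul]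
  congr 1
  exact (ENNReal.eq_inv_of_mul_eq_one_left h2.symm).symm

instance isProbabilityMeasure_uniformSphere [Nontrivial E] :
    IsProbabilityMeasure (uniformSphere E) := by
  constructor
  have h := lintegral_uniformSphere (E := E) (g := fun _ => 1) measurable_const
  simpa using h

end Gaussian

/-! ### Concentration and anti-concentration of a coordinate on the sphere -/

section SphereEstimates

variable {E : Type*} [NormedAddCommGroup E] [InnerProductSpace ℝ E] [FiniteDimensional ℝ E]
  [MeasurableSpace E] [BorelSpace E]

theorem lintegral_exp_inner_sq_stdGaussian_le [Nontrivial E] {y : E} (hy : ‖y‖ ≤ 1) :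
    ∫⁻ x, ENNReal.ofReal (Real.exp (1 / 4 * inner ℝ x y ^ 2)) ∂stdGaussian E ≤ 2 := by
  obtain ⟨e, he, hle⟩ : ∃ e : E, ‖e‖ = 1 ∧ ∀ x : E, inner ℝ x y ^ 2 ≤ inner ℝ e x ^ 2 := by
    by_cases h0 : y = 0
    · obtain ⟨e, he⟩ := exists_norm_eq E (zero_le_one (α := ℝ))
      exact ⟨e, he, fun x => by simpa [h0] using sq_nonneg _⟩
    · have hpos : 0 < ‖y‖ := norm_pos_iff.2 h0
      refine ⟨‖y‖⁻¹ • y, by rw [norm_smul, norm_inv, norm_norm, inv_mul_cancel₀ hpos.ne'],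
        fun x => ?_⟩
      rw [real_inner_smul_left, mul_pow, real_inner_comm]
      exact le_mul_of_one_le_left (sq_nonneg _) (one_le_pow₀ (one_le_inv_iff₀.2 ⟨hpos, hy⟩))
  calc ∫⁻ x, ENNReal.ofReal (Real.exp (1 / 4 * inner ℝ x y ^ 2)) ∂stdGaussian E
      ≤ ∫⁻ x, ENNReal.ofReal (Real.exp (1 / 4 * inner ℝ e x ^ 2)) ∂stdGaussian E := by
        refine lintegral_mono fun x => ENNReal.ofReal_le_ofReal (Real.exp_le_exp.2 ?_)
        exact mul_le_mul_of_nonneg_left (hle x) (by norm_num)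
    _ = ∫⁻ z, ENNReal.ofReal (Real.exp (1 / 4 * z ^ 2))
          ∂(stdGaussian E).map (fun x => inner ℝ e x) := by
        rw [lintegral_map (by fun_prop) (by fun_prop)]
    _ = ENNReal.ofReal ((1 / 2) ^ (-(1 / 2 : ℝ))) := by
        rw [map_inner_stdGaussian he]
        have h := lintegral_exp_sq_norm_stdGaussian (E := ℝ) (l := -(1 / 4)) (by norm_num)
        norm_num at h ⊢
        exact h
    _ ≤ 2 := by
        rw [Real.rpow_neg (by norm_num), ← Real.inv_rpow (by norm_num)]
        refine ENNReal.ofReal_le_of_le_toReal ?_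
        calc ((1 / 2 : ℝ)⁻¹) ^ (1 / 2 : ℝ) ≤ ((1 / 2 : ℝ)⁻¹) ^ (1 : ℝ) :=
              Real.rpow_le_rpow_of_exponent_le (by norm_num) (by norm_num)
          _ ≤ _ := by norm_num

/-- A Gaussian vector in dimension m rarely has squared norm below m/4. Away from that event,
normalizing inflates the squared coordinate by at most 4/m, and a one-dimensional Gaussian integral
remains. -/
theorem lintegral_exp_inner_sq_uniformSphere_le [Nontrivial E] {y : E} (hy : ‖y‖ ≤ 1) :
    ∫⁻ v, ENNReal.ofReal (Real.exp (Module.finrank ℝ E / 16 * inner ℝ (v : E) y ^ 2))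
      ∂uniformSphere E ≤ 3 := by
  rw [lintegral_uniformSphere (g := fun v => ENNReal.ofReal
    (Real.exp (Module.finrank ℝ E / 16 * inner ℝ v y ^ 2))) (by fun_prop)]
  set m : ℝ := (Module.finrank ℝ E : ℝ) with hm
  have hm0 : 0 ≤ m := Nat.cast_nonneg _
  -- The second term covers ‖x‖² < m/4: there its exponent is at least 7m/16 - 3m/8 = m/16, the
  -- trivial bound for the left side. Its integral is e^{7m/16} · 4^{-m/2} ≤ 1, because 7/16 < log
  -- 2.
  have hpt : ∀ x : E, ENNReal.ofReal (Real.exp (m / 16 * inner ℝ (‖x‖⁻¹ • x) y ^ 2)) ≤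
      ENNReal.ofReal (Real.exp (1 / 4 * inner ℝ x y ^ 2)) +
        ENNReal.ofReal (Real.exp (7 / 16 * m)) *
          ENNReal.ofReal (Real.exp (-(3 / 2) * ‖x‖ ^ 2)) := by
    intro x
    rw [← ENNReal.ofReal_mul (Real.exp_pos _).le, ← Real.exp_add,
      ← ENNReal.ofReal_add (Real.exp_pos _).le (Real.exp_pos _).le]
    refine ENNReal.ofReal_le_ofReal ?_
    rcases le_or_gt (m / 4) (‖x‖ ^ 2) with h | h
    · refine le_add_of_le_of_nonneg (Real.exp_le_exp.2 ?_) (Real.exp_pos _).le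
      rw [real_inner_smul_left, mul_pow, ← mul_assoc]
      refine mul_le_mul_of_nonneg_right ?_ (sq_nonneg _)
      by_cases hx : ‖x‖ = 0
      · simp [hx]
      · rw [inv_pow, ← div_eq_mul_inv, div_le_iff₀ (by positivity)]
        linarith
    · refine le_add_of_nonneg_of_le (Real.exp_pos _).le (Real.exp_le_exp.2 ?_)
      have h1 : inner ℝ (‖x‖⁻¹ • x) y ^ 2 ≤ 1 := by
        rw [sq_le_one_iff_abs_le_one]
        refine (abs_real_inner_le_norm _ _).trans (mul_le_one₀ ?_ (norm_nonneg _) hy)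
        rw [norm_smul, norm_inv, norm_norm]
        exact inv_mul_le_one
      nlinarith
  refine (lintegral_mono hpt).trans ?_
  rw [lintegral_add_left (by fun_prop), lintegral_const_mul _ (by fun_prop),
    lintegral_exp_sq_norm_stdGaussian (by norm_num)]
  have h2 : ENNReal.ofReal (Real.exp (7 / 16 * m)) *
      ENNReal.ofReal ((1 + 2 * (3 / 2)) ^ (-(Module.finrank ℝ E : ℝ) / 2)) ≤ 1 := by
    rw [← ENNReal.ofReal_mul (Real.exp_pos _).le, ← hm, ENNReal.ofReal_le_one,
      Real.rpow_def_of_pos (by norm_num), ← Real.exp_add, Real.exp_le_one_iff]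
    have h4 : Real.log (1 + 2 * (3 / 2)) = 2 * Real.log 2 := by
      rw [show (1 + 2 * (3 / 2) : ℝ) = 2 ^ 2 by norm_num, Real.log_pow]; norm_num
    rw [h4]
    have := Real.log_two_gt_d9
    nlinarith
  calc _ ≤ (2 : ENNReal) + 1 := add_le_add (lintegral_exp_inner_sq_stdGaussian_le hy) h2
    _ = 3 := by norm_num

/-- If the Gaussian vector has norm less than 3√m, a coordinate below -3T stays below -T/√m after
normalizing; larger norms cost at most e^{-m}. This gives a lower bound for spherical caps at scale
1/√m that does not degenerate with the dimension. -/
theorem stdGaussian_Iio_le_uniformSphere [Nontrivial E] {e : E} (he : ‖e‖ = 1) {T : ℝ}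
    (hT : 0 < T) :
    stdGaussian ℝ (Set.Iio (-(3 * T))) ≤
      uniformSphere E {v | inner ℝ e (v : E) < -(T / Real.sqrt (Module.finrank ℝ E))} +
        ENNReal.ofReal (Real.exp (-Module.finrank ℝ E)) := by
  have hm0 : 0 < (Module.finrank ℝ E : ℝ) := Nat.cast_pos.2 Module.finrank_pos
  set m : ℝ := (Module.finrank ℝ E : ℝ) with hm
  have hs : 0 < Real.sqrt m := Real.sqrt_pos.2 hm0
  have hA : MeasurableSet {v : E | inner ℝ e v < -(T / Real.sqrt m)} :=
    measurableSet_lt (by fun_prop) (by fun_prop)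
  have h1 : uniformSphere E {v | inner ℝ e (v : E) < -(T / Real.sqrt m)} =
      stdGaussian E {x | inner ℝ e (‖x‖⁻¹ • x) < -(T / Real.sqrt m)} := by
    have h := lintegral_uniformSphere (E := E)
      (g := Set.indicator {v : E | inner ℝ e v < -(T / Real.sqrt m)} 1)
      (measurable_one.indicator hA)
    have h3 : MeasurableSet {v : Metric.sphere (0 : E) 1 | inner ℝ e (v : E) < -(T / Real.sqrt m)} :=
      measurableSet_lt (by fun_prop) (by fun_prop)
    have h4 : MeasurableSet {x : E | inner ℝ e (‖x‖⁻¹ • x) < -(T / Real.sqrt m)} :=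
      measurableSet_lt (by fun_prop) (by fun_prop)
    rw [← lintegral_indicator_one h3, ← lintegral_indicator_one h4]
    exact h
  have h2 : stdGaussian ℝ (Set.Iio (-(3 * T))) = stdGaussian E {x | inner ℝ e x < -(3 * T)} := by
    rw [← map_inner_stdGaussian he, Measure.map_apply (by fun_prop) measurableSet_Iio]
    rfl
  have hsub : {x : E | inner ℝ e x < -(3 * T)} ⊆
      {x | inner ℝ e (‖x‖⁻¹ • x) < -(T / Real.sqrt m)} ∪ {x | 9 * m ≤ ‖x‖ ^ 2} := by
    intro x hx
    rcases le_or_gt (9 * m) (‖x‖ ^ 2) with h | h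
    · exact Or.inr h
    left
    simp only [Set.mem_ofPred_eq] at hx ⊢
    have hx0 : 0 < ‖x‖ := by
      rw [norm_pos_iff]
      rintro rfl
      simp at hx
      linarith
    have hlt : ‖x‖ < 3 * Real.sqrt m := by
      refine lt_of_pow_lt_pow_left₀ 2 (by positivity) ?_
      rw [mul_pow, Real.sq_sqrt hm0.le]
      linarith
    rw [real_inner_smul_right, inv_mul_lt_iff₀ hx0]
    have : ‖x‖ * (T / Real.sqrt m) < 3 * T := by
      rw [mul_div_assoc', div_lt_iff₀ hs]
      nlinarith
    linarith
  -- Markov's inequality for exp(‖x‖²/4) gives e^{-9m/4} · 2^{m/2}.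
  have h5 : stdGaussian E {x | 9 * m ≤ ‖x‖ ^ 2} ≤ ENNReal.ofReal (Real.exp (-m)) := by
    have hmk := mul_meas_ge_le_lintegral₀ (μ := stdGaussian E)
      (f := fun x : E => ENNReal.ofReal (Real.exp (-(-(1 / 4)) * ‖x‖ ^ 2))) (by fun_prop)
      (ENNReal.ofReal (Real.exp (9 / 4 * m)))
    rw [lintegral_exp_sq_norm_stdGaussian (by norm_num), ← hm] at hmk
    have hsub2 : {x : E | 9 * m ≤ ‖x‖ ^ 2} ⊆ {x : E | ENNReal.ofReal (Real.exp (9 / 4 * m)) ≤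
        ENNReal.ofReal (Real.exp (-(-(1 / 4)) * ‖x‖ ^ 2))} := by
      intro x hx
      simp only [Set.mem_ofPred_eq] at hx ⊢
      refine ENNReal.ofReal_le_ofReal (Real.exp_le_exp.2 ?_)
      linarith
    have h6 := (mul_le_mul_right (measure_mono (μ := stdGaussian E) hsub2) _).trans hmk
    rw [mul_comm, ← ENNReal.le_div_iff_mul_le
      (Or.inl (by simp [Real.exp_pos])) (Or.inl ENNReal.ofReal_ne_top),
      ← ENNReal.ofReal_div_of_pos (Real.exp_pos _)] at h6
    refine h6.trans (ENNReal.ofReal_le_ofReal ?_)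
    rw [div_le_iff₀ (Real.exp_pos _), ← Real.exp_add, Real.rpow_def_of_pos (by norm_num),
      Real.exp_le_exp]
    have h7 : Real.log (1 + 2 * -(1 / 4)) = - Real.log 2 := by
      rw [show (1 + 2 * -(1 / 4) : ℝ) = 2⁻¹ by norm_num, Real.log_inv]
    rw [h7]
    have := Real.log_two_lt_d9
    nlinarith
  rw [h1, h2]
  exact (measure_mono hsub).trans ((measure_union_le _ _).trans (add_le_add le_rfl h5))

theorem stdGaussian_Iio_pos (t : ℝ) : 0 < stdGaussian ℝ (Set.Iio t) := by
  rw [pos_iff_ne_zero, stdGaussian_eq_withDensity]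
  intro h
  have hmeas : Measurable fun x : ℝ => gaussianRadial (Module.finrank ℝ ℝ) ‖x‖ :=
    (measurable_gaussianRadial _).comp measurable_norm
  rw [withDensity_apply_eq_zero hmeas] at h
  have h1 : {x : ℝ | gaussianRadial (Module.finrank ℝ ℝ) ‖x‖ ≠ 0} = Set.univ := by
    ext x
    have := Real.pi_pos
    simp only [gaussianRadial, ne_eq, ENNReal.ofReal_eq_zero, not_le, Set.mem_ofPred_eq,
      Set.mem_univ, iff_true]
    positivity
  rw [h1, Set.univ_inter] at h
  simp at h

end SphereEstimates

/-! ### One step of the walk, seen through a fixed linear functional -/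

section StepLaw

variable {n : ℕ}

theorem finrank_orthogonal_unitSphere (hn : 2 ≤ n) (u : UnitSphere n) :
    Module.finrank ℝ (Submodule.span ℝ {(u : EuclideanSpace ℝ (Fin n))})ᗮ = n - 1 := by
  have hu : (u : EuclideanSpace ℝ (Fin n)) ≠ 0 := by
    intro h
    have := norm_eq_of_mem_sphere u
    simp [h] at this
  have : Fact (Module.finrank ℝ (EuclideanSpace ℝ (Fin n)) = (n - 1) + 1) :=
    ⟨by simp; omega⟩
  exact Submodule.finrank_orthogonal_span_singleton hu

theorem nontrivial_orthogonal_unitSphere (hn : 2 ≤ n) (u : UnitSphere n) :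
    Nontrivial (Submodule.span ℝ {(u : EuclideanSpace ℝ (Fin n))})ᗮ := by
  apply Module.nontrivial_of_finrank_pos (R := ℝ)
  rw [finrank_orthogonal_unitSphere hn u]
  omega

theorem measurable_sphereStep (θ : ℝ) (u : UnitSphere n) : Measurable (sphereStep θ u) := by
  unfold sphereStep
  exact Measurable.subtype_mk (by fun_prop)

theorem isProbabilityMeasure_stepLaw (hn : 2 ≤ n) (θ : ℝ) (u : UnitSphere n) :
    IsProbabilityMeasure (stepLaw θ u) := by
  have := nontrivial_orthogonal_unitSphere hn u
  exact Measure.isProbabilityMeasure_map (measurable_sphereStep θ u).aemeasurable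

/-- The inner product of `y` with the endpoint of a step from `u`, in terms of the component
of `y` orthogonal to `u`. -/
theorem exists_inner_sphereStep (θ : ℝ) (u : UnitSphere n) (y : EuclideanSpace ℝ (Fin n)) :
    ∃ z : (Submodule.span ℝ {(u : EuclideanSpace ℝ (Fin n))})ᗮ,
      ‖z‖ ^ 2 = ‖y‖ ^ 2 - inner ℝ (u : EuclideanSpace ℝ (Fin n)) y ^ 2 ∧
      ∀ v, inner ℝ (sphereStep θ u v : EuclideanSpace ℝ (Fin n)) y =
        Real.cos θ * inner ℝ (u : EuclideanSpace ℝ (Fin n)) y +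
          Real.sin θ * inner ℝ (v : (Submodule.span ℝ {(u : EuclideanSpace ℝ (Fin n))})ᗮ) z := by
  have hu : ‖(u : EuclideanSpace ℝ (Fin n))‖ = 1 := norm_eq_of_mem_sphere u
  set a := inner ℝ (u : EuclideanSpace ℝ (Fin n)) y with ha
  refine ⟨⟨y - a • (u : EuclideanSpace ℝ (Fin n)), ?_⟩, ?_, fun v => ?_⟩
  · rw [Submodule.mem_orthogonal_singleton_iff_inner_right, inner_sub_right,
      real_inner_smul_right, real_inner_self_eq_norm_sq, hu]
    simp [ha]
  · rw [Submodule.coe_norm, norm_sub_sq_real, real_inner_smul_right, norm_smul, hu,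
      real_inner_comm, ← ha, mul_one, Real.norm_eq_abs, sq_abs]
    ring
  · have huv := Submodule.mem_orthogonal_singleton_iff_inner_left.1 v.1.2
    simp only [sphereStep, inner_add_left, real_inner_smul_left, Submodule.coe_inner,
      inner_sub_right, real_inner_smul_right, huv]
    simp [ha]

/-- The squared projection contracts by cos θ in exponential mean, at the cost of a factor 3 from
the fluctuation. This drift condition feeds the energy bound. -/
theorem lintegral_exp_inner_sq_stepLaw_le (hn : 2 ≤ n) {θ : ℝ}
    (hθ : θ ∈ Set.Ioo 0 (Real.pi / 2)) (u : UnitSphere n) {y : EuclideanSpace ℝ (Fin n)}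
    (hy : ‖y‖ ≤ 1) :
    ∫⁻ w, ENNReal.ofReal (Real.exp (n / 64 * inner ℝ (w : EuclideanSpace ℝ (Fin n)) y ^ 2))
        ∂stepLaw θ u ≤
      3 * ENNReal.ofReal (Real.exp
        (n / 64 * (Real.cos θ * inner ℝ (u : EuclideanSpace ℝ (Fin n)) y ^ 2))) := by
  have := nontrivial_orthogonal_unitSphere hn u
  obtain ⟨z, hz, hstep⟩ := exists_inner_sphereStep θ u y
  have hz1 : ‖z‖ ≤ 1 := by
    rw [← sq_le_one_iff₀ (norm_nonneg _), hz]
    nlinarith [norm_nonneg y, sq_nonneg (inner ℝ (u : EuclideanSpace ℝ (Fin n)) y)]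
  rw [stepLaw, lintegral_map (by fun_prop) (measurable_sphereStep θ u)]
  set a := inner ℝ (u : EuclideanSpace ℝ (Fin n)) y
  set c := Real.cos θ
  set s := Real.sin θ
  have hc1 : 0 < 1 - c := by
    have h : c < Real.cos 0 := Real.cos_lt_cos_of_nonneg_of_le_pi_div_two le_rfl hθ.2.le hθ.1
    rw [Real.cos_zero] at h
    linarith
  have hc0 : 0 ≤ c := Real.cos_nonneg_of_mem_Icc ⟨by linarith [hθ.1, hθ.2], hθ.2.le⟩
  have hsc : s ^ 2 + c ^ 2 = 1 := Real.sin_sq_add_cos_sq θ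
  -- The square ((1 - c)a - sξ)² ≥ 0, divided by 1 - c, gives this even with 1 + c in place of 2.
  -- With n ≤ 2(n - 1), the weight n/64 on 2ξ² is then within the (n - 1)/16 allowed by the
  -- spherical bound.
  have hsq : ∀ ξ : ℝ, (c * a + s * ξ) ^ 2 ≤ c * a ^ 2 + 2 * ξ ^ 2 := by
    intro ξ
    have h1 : 0 ≤ (1 - c) * ((1 - c) * a ^ 2 - 2 * s * ξ * a + (1 + c) * ξ ^ 2) := by
      have : (1 - c) * ((1 - c) * a ^ 2 - 2 * s * ξ * a + (1 + c) * ξ ^ 2) =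
          ((1 - c) * a - s * ξ) ^ 2 := by linear_combination -ξ ^ 2 * hsc
      rw [this]
      positivity
    have h2 := mul_nonneg hc0 (nonneg_of_mul_nonneg_right h1 hc1)
    have h3 : (c * a + s * ξ) ^ 2 = c ^ 2 * a ^ 2 + 2 * c * s * ξ * a + (1 - c ^ 2) * ξ ^ 2 := by
      linear_combination ξ ^ 2 * hsc
    nlinarith [mul_nonneg hc1.le (sq_nonneg ξ)]
  have hnm : (n : ℝ) ≤ 2 * ((n - 1 : ℕ) : ℝ) := by
    have : n ≤ 2 * (n - 1) := by omega
    exact_mod_cast this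
  have hfr := finrank_orthogonal_unitSphere hn u
  have h3 := lintegral_exp_inner_sq_uniformSphere_le hz1
  rw [hfr] at h3
  refine (lintegral_mono fun v => ?_).trans ((lintegral_const_mul
    (ENNReal.ofReal (Real.exp (n / 64 * (c * a ^ 2))))
    (f := fun v : Metric.sphere (0 : (Submodule.span ℝ {(u : EuclideanSpace ℝ (Fin n))})ᗮ) 1 =>
      ENNReal.ofReal (Real.exp (((n - 1 : ℕ) : ℝ) / 16 * inner ℝ (v : (Submodule.span ℝ {(u : EuclideanSpace ℝ (Fin n))})ᗮ) z ^ 2)))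
    (by fun_prop)).trans_le ?_)
  · rw [← ENNReal.ofReal_mul (Real.exp_pos _).le, ← Real.exp_add, hstep]
    refine ENNReal.ofReal_le_ofReal (Real.exp_le_exp.2 ?_)
    set ξ := inner ℝ (v : (Submodule.span ℝ {(u : EuclideanSpace ℝ (Fin n))})ᗮ) z
    have := mul_le_mul_of_nonneg_left (hsq ξ) (by positivity : (0 : ℝ) ≤ n / 64)
    nlinarith [mul_le_mul_of_nonneg_right hnm (sq_nonneg ξ)]
  · rw [mul_comm]
    exact mul_le_mul_left h3 _

/-- When the current projection is O(1/√n), `y` is almost orthogonal to `u`, so the random part of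
the step has Gaussian size 1/√n and overcomes the drift with probability independent of n. -/
theorem exists_le_stepLaw {θ : ℝ} (hθ : θ ∈ Set.Ioo 0 (Real.pi / 2)) {K : ℝ} (hK : 0 < K) :
    ∃ p : ℝ, 0 < p ∧ ∃ n₀ : ℕ, 2 ≤ n₀ ∧ ∀ n : ℕ, n₀ ≤ n → ∀ (u : UnitSphere n)
      (y : EuclideanSpace ℝ (Fin n)), ‖y‖ = 1 →
      |inner ℝ (u : EuclideanSpace ℝ (Fin n)) y| ≤ K / Real.sqrt n →
      ENNReal.ofReal p ≤ stepLaw θ u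
        {w | inner ℝ (w : EuclideanSpace ℝ (Fin n)) y < -(1 / Real.sqrt n)} := by
  have hs : 0 < Real.sin θ := Real.sin_pos_of_pos_of_lt_pi hθ.1 (by linarith [hθ.2, Real.pi_pos])
  set s := Real.sin θ with hsdef
  -- Chosen so that s · (1/2) · T = K + 1: the K cancels the drift, the 1 is the required margin,
  -- and 1/2 is the lower bound for ‖z‖.
  set T : ℝ := 2 * (K + 1) / s with hT
  have hT0 : 0 < T := by positivity
  set q := (stdGaussian ℝ (Set.Iio (-(3 * T)))).toReal with hq
  have hq0 : 0 < q := ENNReal.toReal_pos (stdGaussian_Iio_pos _).ne' (measure_ne_top _ _)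
  -- `n₁` makes the error e^{-(n-1)} at most half of the Gaussian tail `q`; `n₂` makes K²/n ≤ 3/4,
  -- whence ‖z‖ ≥ 1/2.
  obtain ⟨n₁, hn₁⟩ := exists_nat_ge (-Real.log (q / 2) + 1)
  obtain ⟨n₂, hn₂⟩ := exists_nat_ge (4 / 3 * K ^ 2)
  refine ⟨q / 2, by positivity, max 2 (max n₁ n₂), le_max_left _ _,
    fun n hn u y hy ha => ?_⟩
  have hn2 : 2 ≤ n := (le_max_left _ _).trans hn
  have hn1 : (n₁ : ℝ) ≤ n := by
    exact_mod_cast (le_max_left n₁ n₂).trans ((le_max_right _ _).trans hn)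
  have hn3 : (n₂ : ℝ) ≤ n := by
    exact_mod_cast (le_max_right n₁ n₂).trans ((le_max_right _ _).trans hn)
  have hn0 : (0 : ℝ) < n := by
    have : 0 < n := by omega
    exact_mod_cast this
  have hsn : 0 < Real.sqrt n := Real.sqrt_pos.2 hn0
  have := nontrivial_orthogonal_unitSphere hn2 u
  have hfr := finrank_orthogonal_unitSphere hn2 u
  obtain ⟨z, hz, hstep⟩ := exists_inner_sphereStep θ u y
  set a := inner ℝ (u : EuclideanSpace ℝ (Fin n)) y
  have ha2 : a ^ 2 ≤ 3 / 4 := by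
    rw [← sq_abs]
    calc |a| ^ 2 ≤ (K / Real.sqrt n) ^ 2 := by gcongr
      _ = K ^ 2 / n := by rw [div_pow, Real.sq_sqrt hn0.le]
      _ ≤ 3 / 4 := by rw [div_le_iff₀ hn0]; linarith
  have hzh : 1 / 2 ≤ ‖z‖ := by
    refine le_of_sq_le_sq ?_ (norm_nonneg _)
    rw [hz, hy]
    linarith
  have hz0 : 0 < ‖z‖ := by linarith
  have he : ‖(‖z‖⁻¹ • z)‖ = 1 := by
    rw [norm_smul, norm_inv, norm_norm, inv_mul_cancel₀ hz0.ne']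
  have hm : (1 : ℝ) ≤ ((n - 1 : ℕ) : ℝ) := by
    have : 1 ≤ n - 1 := by omega
    exact_mod_cast this
  have hmn : ((n - 1 : ℕ) : ℝ) = n - 1 := by
    rw [Nat.cast_sub (by omega)]; simp
  have hmain := stdGaussian_Iio_le_uniformSphere he hT0
  rw [hfr] at hmain
  have hexp : Real.exp (-((n - 1 : ℕ) : ℝ)) ≤ q / 2 := by
    rw [← Real.le_log_iff_exp_le (by positivity), hmn]
    linarith
  have h1 : ENNReal.ofReal (q / 2) ≤ uniformSphere _
      {v : Metric.sphere (0 : (Submodule.span ℝ {(u : EuclideanSpace ℝ (Fin n))})ᗮ) 1 |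
        inner ℝ (‖z‖⁻¹ • z)
          (v : (Submodule.span ℝ {(u : EuclideanSpace ℝ (Fin n))})ᗮ) < -(T / Real.sqrt ((n - 1 : ℕ) : ℝ))} := by
    have h2 : ENNReal.ofReal q = stdGaussian ℝ (Set.Iio (-(3 * T))) :=
      ENNReal.ofReal_toReal (measure_ne_top _ _)
    rw [← h2] at hmain
    have h3 := hmain.trans (add_le_add le_rfl (ENNReal.ofReal_le_ofReal hexp))
    rw [← add_halves q, ENNReal.ofReal_add (by positivity) (by positivity), add_halves] at h3
    exact (ENNReal.add_le_add_iff_right ENNReal.ofReal_ne_top).1 h3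
  refine h1.trans ?_
  rw [stepLaw, Measure.map_apply (measurable_sphereStep θ u)
    (measurableSet_lt (by fun_prop) (by fun_prop))]
  refine measure_mono fun v hv => ?_
  simp only [Set.mem_ofPred_eq, Set.mem_preimage] at hv ⊢
  rw [hstep]
  rw [real_inner_smul_left, real_inner_comm, inv_mul_lt_iff₀ hz0] at hv
  set ξ := inner ℝ (v : (Submodule.span ℝ {(u : EuclideanSpace ℝ (Fin n))})ᗮ) z
  have hTs : T / Real.sqrt n ≤ T / Real.sqrt ((n - 1 : ℕ) : ℝ) := by
    refine div_le_div_of_nonneg_left hT0.le (Real.sqrt_pos.2 (by linarith))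
      (Real.sqrt_le_sqrt (by linarith))
  have hξ : ξ < -(1 / 2 * (T / Real.sqrt n)) := by
    have h0 : 0 ≤ T / Real.sqrt n := by positivity
    nlinarith
  have hsT : s * (1 / 2 * (T / Real.sqrt n)) = K / Real.sqrt n + 1 / Real.sqrt n := by
    rw [hT]; field_simp
  have hca : Real.cos θ * a ≤ K / Real.sqrt n := by
    refine (le_abs_self _).trans ?_
    rw [abs_mul]
    exact (mul_le_of_le_one_left (abs_nonneg _) (Real.abs_cos_le_one θ)).trans ha
  nlinarith [mul_lt_mul_of_pos_left hξ hs]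

end StepLaw

/-! ### Markov property and exponential supermartingales -/

section MarkovChain

variable {S Ω : Type*} [MeasurableSpace S] [MeasurableSpace Ω] {Q : S → Measure S}
  {W : ℕ → Ω → S} {P : Measure Ω}

theorem IsMarkovChain.past_le (h : IsMarkovChain Q W P) (i : ℕ) :
    (⨆ j ∈ Set.Iic i, MeasurableSpace.comap (W j) inferInstance) ≤ (inferInstance :
      MeasurableSpace Ω) :=
  iSup₂_le fun j _ => (h.measurable j).comap_le

omit [MeasurableSpace Ω] in
theorem measurable_past {i j : ℕ} (hj : j ≤ i) :
    Measurable[⨆ j ∈ Set.Iic i, MeasurableSpace.comap (W j) inferInstance] (W j) :=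
  Measurable.mono (comap_measurable (W j))
    (le_iSup₂_of_le (f := fun j (_ : j ∈ Set.Iic i) => MeasurableSpace.comap (W j) inferInstance)
      j hj le_rfl) le_rfl

/-- `Q` is a bare family of measures, with no measurability in the starting point. Along the chain
it is recovered almost everywhere from the conditional expectation. -/
theorem IsMarkovChain.aemeasurable_apply [∀ u, IsFiniteMeasure (Q u)] (h : IsMarkovChain Q W P)
    (i : ℕ) {B : Set S} (hB : MeasurableSet B) : AEMeasurable (fun ω => Q (W i ω) B) P := by
  have h1 : AEMeasurable (fun ω => (Q (W i ω)).real B) P :=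
    ⟨_, (stronglyMeasurable_condExp.mono (h.past_le i)).measurable, (h.condProb i B hB).symm⟩
  refine h1.ennreal_ofReal.congr (Filter.Eventually.of_forall fun ω => ?_)
  simp

theorem IsMarkovChain.lintegral_mul_indicator [IsFiniteMeasure P] [∀ u, IsFiniteMeasure (Q u)]
    (h : IsMarkovChain Q W P) (i : ℕ) {B : Set S} (hB : MeasurableSet B) {G : Ω → ENNReal}
    (hG : Measurable[⨆ j ∈ Set.Iic i, MeasurableSpace.comap (W j) inferInstance] G) :
    ∫⁻ ω in W (i + 1) ⁻¹' B, G ω ∂P = ∫⁻ ω, G ω * Q (W i ω) B ∂P := by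
  have hle := h.past_le i
  have hae := h.aemeasurable_apply i hB
  have hWB := h.measurable (i + 1) hB
  -- The defining property of the conditional expectation says that these two measures agree on
  -- events of the past; integrating the past-measurable `G` against both gives the claim.
  have key : (P.restrict (W (i + 1) ⁻¹' B)).trim hle =
      (P.withDensity fun ω => Q (W i ω) B).trim hle := by
    refine @Measure.ext _ (_) _ _ fun A hA => ?_
    have hA' := hle A hA
    rw [trim_measurableSet_eq hle hA, trim_measurableSet_eq hle hA, Measure.restrict_apply hA',
      withDensity_apply _ hA']
    have hint : Integrable ((W (i + 1) ⁻¹' B).indicator fun _ => (1 : ℝ)) P :=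
      (integrable_const 1).indicator hWB
    have h1 := setIntegral_condExp hle hint hA
    rw [setIntegral_congr_ae hA' ((h.condProb i B hB).mono fun ω hω _ => hω),
      setIntegral_indicator hWB, setIntegral_const, smul_eq_mul, mul_one] at h1
    have hintQ : Integrable (fun ω => (Q (W i ω)).real B) P :=
      integrable_condExp.congr (h.condProb i B hB)
    have h2 := ofReal_integral_eq_lintegral_ofReal (hintQ.restrict (s := A))
      (Filter.Eventually.of_forall fun ω => measureReal_nonneg)
    rw [h1, ofReal_measureReal] at h2
    rw [h2]
    simp
  have h1 := congrArg (fun ν => @lintegral Ω (_) ν G) key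
  rw [lintegral_trim hle hG, lintegral_trim hle hG,
    lintegral_withDensity_eq_lintegral_mul₀ hae (hG.mono hle le_rfl).aemeasurable] at h1
  rw [h1]
  refine lintegral_congr fun ω => ?_
  simp [mul_comm]

/-- The Markov property for nonnegative functions of the next state. -/
theorem IsMarkovChain.lintegral_mul_comp [IsFiniteMeasure P] [∀ u, IsFiniteMeasure (Q u)]
    (h : IsMarkovChain Q W P) (i : ℕ) {G : Ω → ENNReal}
    (hG : Measurable[⨆ j ∈ Set.Iic i, MeasurableSpace.comap (W j) inferInstance] G)
    {f : S → ENNReal} (hf : Measurable f) :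
    ∫⁻ ω, G ω * f (W (i + 1) ω) ∂P = ∫⁻ ω, G ω * ∫⁻ v, f v ∂Q (W i ω) ∂P := by
  have hGm : Measurable G := hG.mono (h.past_le i) le_rfl
  have hm1 : ∀ {g : S → ENNReal}, Measurable g → Measurable fun ω => G ω * g (W (i + 1) ω) :=
    fun hg => hGm.mul (hg.comp (h.measurable _))
  have hm2 : ∀ {g : Ω → ENNReal}, AEMeasurable g P → AEMeasurable (fun ω => G ω * g ω) P :=
    fun hg => hGm.aemeasurable.mul hg
  -- The induction carries a.e. measurability along, since it is needed to exchange integrals with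
  -- sums and suprema.
  suffices hs : AEMeasurable (fun ω => ∫⁻ v, f v ∂Q (W i ω)) P ∧
      ∫⁻ ω, G ω * f (W (i + 1) ω) ∂P = ∫⁻ ω, G ω * ∫⁻ v, f v ∂Q (W i ω) ∂P from hs.2
  refine Measurable.ennreal_induction (motive := fun f =>
    AEMeasurable (fun ω => ∫⁻ v, f v ∂Q (W i ω)) P ∧
      ∫⁻ ω, G ω * f (W (i + 1) ω) ∂P = ∫⁻ ω, G ω * ∫⁻ v, f v ∂Q (W i ω) ∂P)
    (fun c B hB => ?_) (fun f g _ hf hg ihf ihg => ?_) (fun f hf hmono ih => ?_) hf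
  · have h1 : ∀ ω, ∫⁻ v, B.indicator (fun _ => c) v ∂Q (W i ω) = c * Q (W i ω) B := fun ω => by
      rw [lintegral_indicator_const hB]
    simp_rw [h1]
    refine ⟨(h.aemeasurable_apply i hB).const_mul c, ?_⟩
    have h2 : ∀ ω, G ω * B.indicator (fun _ => c) (W (i + 1) ω) =
        (W (i + 1) ⁻¹' B).indicator (fun ω => c * G ω) ω := fun ω => by
      by_cases hω : W (i + 1) ω ∈ B <;> simp [hω, mul_comm]
    simp_rw [h2]
    rw [lintegral_indicator (h.measurable (i + 1) hB), lintegral_const_mul _ hGm,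
      h.lintegral_mul_indicator i hB hG, ← lintegral_const_mul'' _
        (hm2 (h.aemeasurable_apply i hB))]
    exact lintegral_congr fun ω => by ring
  · have h1 : ∀ ω, ∫⁻ v, (f + g) v ∂Q (W i ω) =
        (∫⁻ v, f v ∂Q (W i ω)) + ∫⁻ v, g v ∂Q (W i ω) := fun ω => lintegral_add_left hf _
    simp_rw [h1, Pi.add_apply, mul_add]
    refine ⟨ihf.1.add ihg.1, ?_⟩
    rw [lintegral_add_left (hm1 hf), lintegral_add_left' (hm2 ihf.1), ihf.2, ihg.2]
  · have h1 : ∀ ω, ∫⁻ v, (⨆ k, f k v) ∂Q (W i ω) = ⨆ k, ∫⁻ v, f k v ∂Q (W i ω) :=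
      fun ω => lintegral_iSup hf hmono
    simp_rw [h1, ENNReal.mul_iSup]
    refine ⟨AEMeasurable.iSup fun k => (ih k).1, ?_⟩
    rw [lintegral_iSup (fun k => hm1 (hf k))
        (fun k l hkl ω => mul_le_mul_right (hmono hkl _) _),
      lintegral_iSup' (fun k => hm2 (ih k).1)
        (Filter.Eventually.of_forall fun ω k l hkl =>
          mul_le_mul_right (lintegral_mono (hmono hkl)) _)]
    exact iSup_congr fun k => (ih k).2

/-- The exponential supermartingale inequality for additive functionals of a Markov chain. -/
theorem IsMarkovChain.measure_le_sum_le [IsProbabilityMeasure P] [∀ u, IsFiniteMeasure (Q u)]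
    (h : IsMarkovChain Q W P) {F H : S → ℝ} (hF : Measurable F) (hH : Measurable H)
    (hFH : ∀ u, ENNReal.ofReal (Real.exp (H u)) *
      ∫⁻ v, ENNReal.ofReal (Real.exp (F v)) ∂Q u ≤ 1) (N : ℕ) (t : ℝ) :
    P {ω | t ≤ ∑ i ∈ Finset.range N, (H (W i ω) + F (W (i + 1) ω))} ≤
      ENNReal.ofReal (Real.exp (-t)) := by
  have hprod : ∀ N, ∫⁻ ω, ENNReal.ofReal (Real.exp (∑ i ∈ Finset.range N,
      (H (W i ω) + F (W (i + 1) ω)))) ∂P ≤ 1 := by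
    intro N
    induction N with
    | zero => simp
    | succ N ih =>
      refine le_trans (b := ∫⁻ ω, ENNReal.ofReal (Real.exp (∑ i ∈ Finset.range N,
          (H (W i ω) + F (W (i + 1) ω)))) * ENNReal.ofReal (Real.exp (H (W N ω))) *
          ∫⁻ v, ENNReal.ofReal (Real.exp (F v)) ∂Q (W N ω) ∂P) (le_of_eq ?_)
        ((lintegral_mono fun ω => ?_).trans ih)
      · rw [← h.lintegral_mul_comp N]
        · refine lintegral_congr fun ω => ?_
          rw [Finset.sum_range_succ, Real.exp_add, Real.exp_add,
            ENNReal.ofReal_mul (Real.exp_pos _).le, ENNReal.ofReal_mul (Real.exp_pos _).le,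
            mul_assoc]
        · refine Measurable.mul (M := ENNReal) (α := Ω) ?_ ?_
          · refine (Real.measurable_exp.comp (Finset.measurable_fun_sum _ fun i hi => ?_)).ennreal_ofReal
            have hi' := Finset.mem_range.1 hi
            exact (hH.comp (measurable_past hi'.le)).add (hF.comp (measurable_past hi'))
          · exact (Real.measurable_exp.comp (hH.comp (measurable_past le_rfl))).ennreal_ofReal
        · exact (Real.measurable_exp.comp hF).ennreal_ofReal
      · rw [mul_assoc]
        exact mul_le_of_le_one_right zero_le (hFH _)
  have hm : Measurable fun ω => ENNReal.ofReal (Real.exp (∑ i ∈ Finset.range N,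
      (H (W i ω) + F (W (i + 1) ω)))) :=
    (Real.measurable_exp.comp (Finset.measurable_fun_sum _ fun i _ =>
      (hH.comp (h.measurable i)).add (hF.comp (h.measurable (i + 1))))).ennreal_ofReal
  have hmk := (mul_meas_ge_le_lintegral hm (ENNReal.ofReal (Real.exp t))).trans (hprod N)
  rw [mul_comm, ← ENNReal.le_div_iff_mul_le (Or.inl (by simp [Real.exp_pos]))
    (Or.inl ENNReal.ofReal_ne_top), one_div, ← ENNReal.ofReal_inv_of_pos (Real.exp_pos _),
    ← Real.exp_neg] at hmk
  refine (measure_mono fun ω hω => ?_).trans hmk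
  exact ENNReal.ofReal_le_ofReal (Real.exp_le_exp.2 hω)

end MarkovChain

/-! ### Nets of the sphere with exponentially many points -/

section Net

variable {E : Type*} [NormedAddCommGroup E] [NormedSpace ℝ E] [FiniteDimensional ℝ E]

/-- The volumetric bound on the cardinality of a separated set in the unit ball. -/
theorem card_le_of_separated_unitBall {ε : ℝ} (hε : 0 < ε) (s : Finset E)
    (hs : ∀ c ∈ s, ‖c‖ ≤ 1) (h : ∀ c ∈ s, ∀ d ∈ s, c ≠ d → ε ≤ ‖c - d‖) :
    (s.card : ℝ) ≤ (1 + 2 / ε) ^ Module.finrank ℝ E := by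
  borelize E
  let μ : Measure E := Measure.addHaar
  have hδ : 0 < ε / 2 := by positivity
  have hρ : 0 < 1 + ε / 2 := by positivity
  have hdisj : Set.Pairwise (s : Set E)
      (Function.onFun Disjoint fun c => Metric.ball (c : E) (ε / 2)) := by
    rintro c hc d hd hcd
    apply Metric.ball_disjoint_ball
    rw [dist_eq_norm, add_halves]
    exact h c hc d hd hcd
  have hsub : (⋃ c ∈ s, Metric.ball (c : E) (ε / 2)) ⊆ Metric.ball (0 : E) (1 + ε / 2) := by
    refine Set.iUnion₂_subset fun x hx => ?_
    apply Metric.ball_subset_ball'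
    rw [dist_zero_right]
    linarith [hs x hx]
  have hvol : (s.card : ENNReal) * ENNReal.ofReal ((ε / 2) ^ Module.finrank ℝ E) *
      μ (Metric.ball 0 1) ≤
      ENNReal.ofReal ((1 + ε / 2) ^ Module.finrank ℝ E) * μ (Metric.ball 0 1) :=
    calc _ = μ (⋃ c ∈ s, Metric.ball (c : E) (ε / 2)) := by
          rw [measure_biUnion_finset hdisj fun c _ => measurableSet_ball]
          simp only [μ.addHaar_ball_of_pos _ hδ, Finset.sum_const, nsmul_eq_mul, mul_assoc]
      _ ≤ μ (Metric.ball (0 : E) (1 + ε / 2)) := measure_mono hsub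
      _ = _ := by simp only [μ.addHaar_ball_of_pos _ hρ]
  have hvol' := (ENNReal.mul_le_mul_iff_left (Metric.measure_ball_pos μ _ zero_lt_one).ne'
    measure_ball_lt_top.ne).1 hvol
  have hreal := ENNReal.toReal_le_of_le_ofReal (pow_nonneg hρ.le _) hvol'
  rw [ENNReal.toReal_mul, ENNReal.toReal_natCast, ENNReal.toReal_ofReal (by positivity),
    ← le_div_iff₀ (by positivity), ← div_pow] at hreal
  have hratio : 1 + 2 / ε = (1 + ε / 2) / (ε / 2) := by
    field_simp
    ring
  rwa [hratio]

-- A separated set of largest cardinality is a net: an uncovered point could be added to it. The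
-- volumetric bound ensures that a largest cardinality exists.
variable (E) in
theorem exists_net_unitSphere {ε : ℝ} (hε : 0 < ε) :
    ∃ s : Finset E, (∀ c ∈ s, ‖c‖ = 1) ∧ (∀ x : E, ‖x‖ = 1 → ∃ c ∈ s, ‖x - c‖ ≤ ε) ∧
      (s.card : ℝ) ≤ (1 + 2 / ε) ^ Module.finrank ℝ E := by
  classical
  let p : Finset E → Prop := fun s =>
    (∀ c ∈ s, ‖c‖ = 1) ∧ ∀ c ∈ s, ∀ d ∈ s, c ≠ d → ε ≤ ‖c - d‖
  have hcard : ∀ s, p s → (s.card : ℝ) ≤ (1 + 2 / ε) ^ Module.finrank ℝ E := fun s hs =>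
    card_le_of_separated_unitBall hε s (fun c hc => (hs.1 c hc).le) hs.2
  obtain ⟨B, hB⟩ := exists_nat_ge ((1 + 2 / ε) ^ Module.finrank ℝ E)
  have hbdd : ∀ k, (∃ s, p s ∧ s.card = k) → k ≤ B := by
    rintro k ⟨s, hs, rfl⟩
    exact_mod_cast (hcard s hs).trans hB
  obtain ⟨s, hs, hmax⟩ := Nat.findGreatest_spec (P := fun k => ∃ s, p s ∧ s.card = k)
    (Nat.zero_le B) ⟨∅, ⟨by simp, by simp⟩, rfl⟩
  refine ⟨s, hs.1, fun x hx => ?_, hcard s hs⟩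
  by_contra! hcon
  have hxs : x ∉ s := fun hxs => by
    have := hcon x hxs
    simp at this
    linarith
  have hins : p (insert x s) := by
    refine ⟨fun c hc => ?_, fun c hc d hd hcd => ?_⟩
    · rcases Finset.mem_insert.1 hc with rfl | hc
      exacts [hx, hs.1 c hc]
    · rcases Finset.mem_insert.1 hc with rfl | hc <;> rcases Finset.mem_insert.1 hd with rfl | hd
      · exact absurd rfl hcd
      · exact (hcon d hd).le
      · rw [norm_sub_rev]
        exact (hcon c (Finset.mem_of_mem_insert_of_ne hc hcd)).le
      · exact hs.2 c hc d hd hcd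
  have h1 := Nat.le_findGreatest (P := fun k => ∃ s, p s ∧ s.card = k)
    (hbdd _ ⟨_, hins, rfl⟩) ⟨_, hins, rfl⟩
  rw [Finset.card_insert_of_notMem hxs] at h1
  omega

end Net

/-! ### Quadratic forms on nets, and convex duality for the covering time -/

section Deterministic

/-- If a linear map is bounded by `M` on a `1/2`-net of the sphere, its norm is at most `2 * M`. -/
theorem opNorm_le_of_net {E F : Type*} [NormedAddCommGroup E] [NormedSpace ℝ E]
    [NormedAddCommGroup F] [NormedSpace ℝ F] (A : E →L[ℝ] F) {s : Set E} {M : ℝ} (hM0 : 0 ≤ M)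
    (hnet : ∀ x : E, ‖x‖ = 1 → ∃ c ∈ s, ‖x - c‖ ≤ 1 / 2) (hM : ∀ c ∈ s, ‖A c‖ ≤ M) :
    ‖A‖ ≤ 2 * M := by
  have h : ‖A‖ ≤ M + 1 / 2 * ‖A‖ := by
    refine ContinuousLinearMap.opNorm_le_of_unit_norm (by positivity) fun x hx => ?_
    obtain ⟨c, hc, hxc⟩ := hnet x hx
    calc ‖A x‖ = ‖A c + A (x - c)‖ := by rw [← map_add, add_sub_cancel]
      _ ≤ ‖A c‖ + ‖A‖ * ‖x - c‖ := (norm_add_le _ _).trans (by gcongr; exact A.le_opNorm _)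
      _ ≤ M + 1 / 2 * ‖A‖ := by
        rw [mul_comm (1 / 2 : ℝ)]
        gcongr
        exact hM c hc
  linarith

/-- A quadratic form `∑ ⟪w i, x⟫²` bounded on a `1/2`-net of the sphere is bounded. -/
theorem sum_inner_sq_le_of_net {E : Type*} [NormedAddCommGroup E] [InnerProductSpace ℝ E]
    [FiniteDimensional ℝ E] (w : ℕ → E) (N : ℕ) {s : Set E} {M : ℝ} (hM0 : 0 ≤ M)
    (hnet : ∀ x : E, ‖x‖ = 1 → ∃ c ∈ s, ‖x - c‖ ≤ 1 / 2)
    (hM : ∀ c ∈ s, ∑ i ∈ Finset.range N, inner ℝ (w i) c ^ 2 ≤ M) (x : E) :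
    ∑ i ∈ Finset.range N, inner ℝ (w i) x ^ 2 ≤ 4 * M * ‖x‖ ^ 2 := by
  let A : E →L[ℝ] EuclideanSpace ℝ (Fin N) := LinearMap.toContinuousLinearMap
    { toFun := fun x => WithLp.toLp 2 fun i => inner ℝ (w i) x
      map_add' := fun x y => by ext i; simp [inner_add_right]
      map_smul' := fun r x => by ext i; simp [inner_smul_right] }
  have hA : ∀ x, ‖A x‖ ^ 2 = ∑ i ∈ Finset.range N, inner ℝ (w i) x ^ 2 := fun x => by
    rw [EuclideanSpace.norm_sq_eq, Finset.sum_range]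
    simp [A]
  have hop := opNorm_le_of_net A (Real.sqrt_nonneg M) hnet fun c hc =>
    Real.le_sqrt_of_sq_le ((hA c).trans_le (hM c hc))
  rw [← hA]
  calc ‖A x‖ ^ 2 ≤ (2 * Real.sqrt M * ‖x‖) ^ 2 := by
        gcongr
        exact A.le_of_opNorm_le hop x
    _ = 4 * M * ‖x‖ ^ 2 := by rw [mul_pow, mul_pow, Real.sq_sqrt hM0]; ring

variable {n : ℕ}

/-- Finiteness makes the hull closed, so Hahn–Banach separates the origin strictly; conversely an
open half-space is convex and misses the origin. -/
theorem zero_notMem_convexHull_iff {E : Type*} [NormedAddCommGroup E] [InnerProductSpace ℝ E]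
    [CompleteSpace E] {A : Set E} (hA : A.Finite) :
    (0 : E) ∉ convexHull ℝ A ↔ ∃ x : E, ∀ a ∈ A, 0 < inner ℝ x a := by
  constructor
  · intro h
    obtain ⟨f, r, hr, hf⟩ := geometric_hahn_banach_point_closed (convex_convexHull ℝ A)
      (hA.isClosed_convexHull ℝ) h
    rw [map_zero] at hr
    refine ⟨(InnerProductSpace.toDual ℝ E).symm f, fun a ha => ?_⟩
    rw [InnerProductSpace.toDual_symm_apply]
    exact hr.trans (hf a (subset_convexHull ℝ A ha))
  · rintro ⟨x, hx⟩ h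
    have hconv : Convex ℝ {a : E | 0 < inner ℝ x a} :=
      convex_halfSpace_gt (𝕜 := ℝ) (f := fun a => inner ℝ x a)
        ⟨fun _ _ => inner_add_right _ _ _, fun _ _ => real_inner_smul_right _ _ _⟩ 0
    have : 0 < inner ℝ x (0 : E) := convexHull_min (t := {a : E | 0 < inner ℝ x a}) hx hconv h
    rw [inner_zero_right] at this
    exact this.false

/-- The infimum over a nonempty finite set is attained, and an angle is at most π/2 exactly when the
inner product is nonnegative. The empty set fails because its infimum is ∞. -/
theorem isGeodesicCovering_half_pi_iff {A : Set (UnitSphere n)} (hA : A.Finite) :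
    IsGeodesicCovering (Real.pi / 2) A ↔
      ∀ x : UnitSphere n, ∃ y ∈ A,
        0 ≤ inner ℝ (x : EuclideanSpace ℝ (Fin n)) (y : EuclideanSpace ℝ (Fin n)) := by
  refine forall_congr' fun x => ?_
  have hang : ∀ y : UnitSphere n, ENNReal.ofReal (InnerProductGeometry.angle
      (x : EuclideanSpace ℝ (Fin n)) (y : EuclideanSpace ℝ (Fin n))) ≤
        ENNReal.ofReal (Real.pi / 2) ↔
      0 ≤ inner ℝ (x : EuclideanSpace ℝ (Fin n)) (y : EuclideanSpace ℝ (Fin n)) := fun y => by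
    rw [ENNReal.ofReal_le_ofReal_iff (by positivity),
      InnerProductGeometry.angle, Real.arccos_le_pi_div_two, norm_eq_of_mem_sphere,
      norm_eq_of_mem_sphere, mul_one, div_one]
  constructor
  · intro h
    rcases A.eq_empty_or_nonempty with rfl | hne
    · simp at h
    · obtain ⟨y, hy, hmin⟩ := Set.exists_min_image A (fun y : UnitSphere n =>
        ENNReal.ofReal (InnerProductGeometry.angle (x : EuclideanSpace ℝ (Fin n))
          (y : EuclideanSpace ℝ (Fin n)))) hA hne
      exact ⟨y, hy, (hang y).1 ((le_iInf₂ hmin).trans h)⟩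
  · rintro ⟨y, hy, hxy⟩
    exact (iInf₂_le y hy).trans ((hang y).2 hxy)

theorem exists_unit_of_zero_notMem_convexHull (hn : 1 ≤ n) {A : Set (EuclideanSpace ℝ (Fin n))}
    (hA : A.Finite) (h : (0 : EuclideanSpace ℝ (Fin n)) ∉ convexHull ℝ A) :
    ∃ x : EuclideanSpace ℝ (Fin n), ‖x‖ = 1 ∧ ∀ a ∈ A, 0 < inner ℝ x a := by
  obtain ⟨x, hx⟩ := (zero_notMem_convexHull_iff hA).1 h
  by_cases h0 : x = 0
  · have : Nontrivial (EuclideanSpace ℝ (Fin n)) := by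
      apply Module.nontrivial_of_finrank_pos (R := ℝ)
      rw [finrank_euclideanSpace_fin]
      omega
    obtain ⟨e, he⟩ := exists_norm_eq (EuclideanSpace ℝ (Fin n)) (zero_le_one (α := ℝ))
    refine ⟨e, he, fun a ha => ?_⟩
    simpa [h0] using hx a ha
  · have hpos : 0 < ‖x‖ := norm_pos_iff.2 h0
    refine ⟨‖x‖⁻¹ • x, by rw [norm_smul, norm_inv, norm_norm, inv_mul_cancel₀ hpos.ne'],
      fun a ha => ?_⟩
    rw [real_inner_smul_left]
    exact mul_pos (inv_pos.2 hpos) (hx a ha)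

theorem zero_mem_convexHull_iff_isGeodesicCovering (hn : 1 ≤ n) {A : Set (UnitSphere n)}
    (hA : A.Finite) :
    (0 : EuclideanSpace ℝ (Fin n)) ∈
        convexHull ℝ ((fun a : UnitSphere n => (a : EuclideanSpace ℝ (Fin n))) '' A) ↔
      IsGeodesicCovering (Real.pi / 2) A := by
  rw [isGeodesicCovering_half_pi_iff hA]
  constructor
  · intro h x
    by_contra! hx
    refine (zero_notMem_convexHull_iff (hA.image _)).2
      ⟨-(x : EuclideanSpace ℝ (Fin n)), ?_⟩ h
    rintro _ ⟨a, ha, rfl⟩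
    rw [inner_neg_left, neg_pos]
    exact hx a ha
  · intro h
    by_contra hcon
    obtain ⟨x, hx1, hx⟩ := exists_unit_of_zero_notMem_convexHull hn (hA.image _) hcon
    obtain ⟨y, hy, hxy⟩ := h ⟨-x, by simp [hx1]⟩
    have := hx _ ⟨y, hy, rfl⟩
    simp only [inner_neg_left] at hxy
    linarith

theorem IsGeodesicCovering.mono {φ : ℝ} {A B : Set (UnitSphere n)} (h : IsGeodesicCovering φ A)
    (hAB : A ⊆ B) : IsGeodesicCovering φ B :=
  fun x => (iInf_le_iInf_of_subset hAB).trans (h x)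

theorem coveringTime_le_iff {φ : ℝ} {w : ℕ → UnitSphere n} {N : ℕ} :
    coveringTime φ w ≤ (N : ℕ∞) ↔ IsGeodesicCovering φ (w '' {i | i < N}) := by
  constructor
  · intro h
    -- A strict bound on the infimum yields an actual covering index M ≤ N; coverings persist when
    -- points are added.
    have h1 : coveringTime φ w < ((N + 1 : ℕ) : ℕ∞) :=
      h.trans_lt (by exact_mod_cast Nat.lt_succ_self N)
    simp only [coveringTime, iInf_lt_iff] at h1
    obtain ⟨M, hM, hMN⟩ := h1
    have hMN' : M < N + 1 := by exact_mod_cast hMN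
    exact hM.mono (Set.image_mono fun i (hi : i < M) => show i < N by omega)
  · exact fun h => iInf₂_le N h

theorem zero_mem_convexHull_iff_coveringTime_le (hn : 1 ≤ n) (w : ℕ → UnitSphere n) (N : ℕ) :
    (0 : EuclideanSpace ℝ (Fin n)) ∈
        convexHull ℝ ((fun i => (w i : EuclideanSpace ℝ (Fin n))) '' {i | i < N}) ↔
      coveringTime (Real.pi / 2) w ≤ (N : ℕ∞) := by
  rw [coveringTime_le_iff, ← zero_mem_convexHull_iff_isGeodesicCovering hn
    ((Set.finite_lt_nat N).image w), Set.image_image]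

end Deterministic

/-! ### Deviation bounds for a fixed direction, and the passage to all directions -/

section Walk

variable {n : ℕ} {Ω : Type*} [MeasurableSpace Ω] {P : Measure Ω} [IsProbabilityMeasure P]
  {θ : ℝ} {W : ℕ → Ω → UnitSphere n}

theorem IsSphereWalk.measureReal_le_sum_le (hn : 2 ≤ n) (hW : IsSphereWalk θ W P)
    {F H : UnitSphere n → ℝ} (hF : Measurable F) (hH : Measurable H)
    (hFH : ∀ u, ENNReal.ofReal (Real.exp (H u)) *
      ∫⁻ v, ENNReal.ofReal (Real.exp (F v)) ∂stepLaw θ u ≤ 1) (N : ℕ) (t : ℝ) :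
    P.real {ω | t ≤ ∑ i ∈ Finset.range N, (H (W i ω) + F (W (i + 1) ω))} ≤ Real.exp (-t) := by
  have : ∀ u : UnitSphere n, IsFiniteMeasure (stepLaw θ u) := fun u =>
    have := isProbabilityMeasure_stepLaw hn θ u
    inferInstance
  exact ENNReal.toReal_le_of_le_ofReal (Real.exp_pos _).le
    (IsMarkovChain.measure_le_sum_le hW hF hH hFH N t)

/-- With overwhelming probability the squared inner products of the walk with a fixed unit vector
have average of order at most `1 / n`. -/
theorem IsSphereWalk.measureReal_sum_inner_sq_le (hn : 2 ≤ n) (hθ : θ ∈ Set.Ioo 0 (Real.pi / 2))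
    (hW : IsSphereWalk θ W P) {y : EuclideanSpace ℝ (Fin n)} (hy : ‖y‖ = 1) {N : ℕ}
    (hN : n ≤ N + 1) :
    P.real {ω | 256 / (1 - Real.cos θ) * (N + 1) / n < ∑ i ∈ Finset.range (N + 1),
      inner ℝ (W i ω : EuclideanSpace ℝ (Fin n)) y ^ 2} ≤ Real.exp (-(N + 1)) := by
  have hc1 : 0 < 1 - Real.cos θ := by
    have h : Real.cos θ < Real.cos 0 :=
      Real.cos_lt_cos_of_nonneg_of_le_pi_div_two le_rfl hθ.2.le hθ.1
    rw [Real.cos_zero] at h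
    linarith
  have hc0 : 0 ≤ Real.cos θ := Real.cos_nonneg_of_mem_Icc ⟨by linarith [hθ.1, hθ.2], hθ.2.le⟩
  set c := Real.cos θ
  have hn0 : (0 : ℝ) < n := by
    have : 0 < n := by omega
    exact_mod_cast this
  have hNR : (n : ℝ) ≤ N + 1 := by exact_mod_cast hN
  refine le_trans (measureReal_mono ?_) (hW.measureReal_le_sum_le hn
    (F := fun v => n / 64 * inner ℝ (v : EuclideanSpace ℝ (Fin n)) y ^ 2)
    -- The -2 absorbs the factor 3 of the one-step bound, as 3 ≤ e².
    (H := fun u => -(n / 64 * (c * inner ℝ (u : EuclideanSpace ℝ (Fin n)) y ^ 2)) - 2)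
    (by fun_prop) (by fun_prop) (fun u => ?_) N (N + 1))
  · intro ω hω
    simp only [Set.mem_ofPred_eq] at hω ⊢
    set a : ℕ → ℝ := fun i => inner ℝ (W i ω : EuclideanSpace ℝ (Fin n)) y with ha
    have ha0 : a 0 ^ 2 ≤ 1 := by
      rw [sq_le_one_iff_abs_le_one]
      refine (abs_real_inner_le_norm _ _).trans ?_
      rw [norm_eq_of_mem_sphere, hy, one_mul]
    have h1 : ∑ i ∈ Finset.range (N + 1), a i ^ 2 =
        (∑ i ∈ Finset.range N, a (i + 1) ^ 2) + a 0 ^ 2 := Finset.sum_range_succ' _ _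
    have h2 : ∑ i ∈ Finset.range N, a i ^ 2 ≤ ∑ i ∈ Finset.range (N + 1), a i ^ 2 := by
      rw [Finset.sum_range_succ]
      linarith [sq_nonneg (a N)]
    have h3 : ∑ i ∈ Finset.range N, (-(n / 64 * (c * a i ^ 2)) - 2 + n / 64 * a (i + 1) ^ 2) =
        n / 64 * ((∑ i ∈ Finset.range N, a (i + 1) ^ 2) - c * ∑ i ∈ Finset.range N, a i ^ 2) -
          2 * N := by
      simp only [Finset.sum_add_distrib, Finset.sum_sub_distrib, Finset.sum_neg_distrib,
        ← Finset.mul_sum, Finset.sum_const, Finset.card_range, nsmul_eq_mul]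
      ring
    rw [h3]
    change _ < ∑ i ∈ Finset.range (N + 1), a i ^ 2 at hω
    set S := ∑ i ∈ Finset.range (N + 1), a i ^ 2
    have h4 : 256 * ((N : ℝ) + 1) < n * ((1 - c) * S) := by
      rw [div_lt_iff₀ hn0, div_mul_eq_mul_div, div_lt_iff₀ hc1] at hω
      linarith
    -- Shifting the index loses only a_0² ≤ 1. The exponent is then at least 4(N + 1) - n/64 - 2N,
    -- which exceeds N + 1 because n ≤ N + 1.
    have h5 : (1 - c) * S - 1 ≤
        (∑ i ∈ Finset.range N, a (i + 1) ^ 2) - c * ∑ i ∈ Finset.range N, a i ^ 2 := by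
      nlinarith [mul_le_mul_of_nonneg_left h2 hc0]
    have h6 := mul_le_mul_of_nonneg_left h5 hn0.le
    linarith
  · refine (mul_le_mul_right (lintegral_exp_inner_sq_stepLaw_le hn hθ u hy.le) _).trans ?_
    rw [show (3 : ENNReal) = ENNReal.ofReal 3 by simp, ← ENNReal.ofReal_mul (by norm_num),
      ← ENNReal.ofReal_mul (Real.exp_pos _).le, ENNReal.ofReal_le_one,
      mul_left_comm, ← Real.exp_add]
    have h7 : (3 : ℝ) ≤ Real.exp 2 := by
      have := Real.add_one_le_exp (2 : ℝ)
      linarith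
    calc _ = 3 * Real.exp (-2) := by congr 2; ring
      _ ≤ Real.exp 2 * Real.exp (-2) := by gcongr
      _ = 1 := by rw [← Real.exp_add]; simp

/-- Since e^{-1} ≤ 1/2, the integral is at most 1 - p/2 ≤ e^{-p/2}. This is the one-step condition
for counting visits to `B`. -/
theorem exp_mul_lintegral_exp_neg_indicator_le {S : Type*} [MeasurableSpace S] {μ : Measure S}
    [IsProbabilityMeasure μ] {p : ℝ} (hp : 0 < p) {B : Set S} (hB : MeasurableSet B)
    (hpB : ENNReal.ofReal p ≤ μ B) {r : ℝ} (hr : r ≤ p / 2) :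
    ENNReal.ofReal (Real.exp r) *
      ∫⁻ v, ENNReal.ofReal (Real.exp (B.indicator (fun _ => (-1 : ℝ)) v)) ∂μ ≤ 1 := by
  have he : Real.exp (-1) ≤ 1 / 2 := by
    rw [Real.exp_neg, inv_eq_one_div]
    have := Real.add_one_le_exp (1 : ℝ)
    exact one_div_le_one_div_of_le (by norm_num) (by linarith)
  have hp1 : p ≤ 1 := by
    have h := hpB.trans prob_le_one
    rwa [ENNReal.ofReal_le_one] at h
  have h1 : ∫⁻ v, ENNReal.ofReal (Real.exp (B.indicator (fun _ => (-1 : ℝ)) v)) ∂μ +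
      ENNReal.ofReal (1 / 2) * μ B ≤ 1 := by
    rw [← lintegral_indicator_const hB, ← lintegral_add_right _ (measurable_const.indicator hB)]
    calc _ ≤ ∫⁻ _, 1 ∂μ := by
          refine lintegral_mono fun v => ?_
          by_cases hv : v ∈ B
          · simp only [Set.indicator_of_mem hv]
            rw [← ENNReal.ofReal_add (Real.exp_pos _).le (by norm_num), ENNReal.ofReal_le_one]
            linarith
          · simp [Set.indicator_of_notMem hv]
      _ = 1 := by simp
  have h2 : ∫⁻ v, ENNReal.ofReal (Real.exp (B.indicator (fun _ => (-1 : ℝ)) v)) ∂μ ≤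
      ENNReal.ofReal (1 - p / 2) := by
    have h3 := (add_le_add le_rfl (mul_le_mul_right hpB (ENNReal.ofReal (1 / 2)))).trans h1
    rw [← ENNReal.ofReal_mul (by norm_num)] at h3
    rw [ENNReal.ofReal_sub _ (by positivity), ENNReal.ofReal_one]
    refine ENNReal.le_sub_of_add_le_right ENNReal.ofReal_ne_top ?_
    rwa [show p / 2 = 1 / 2 * p by ring]
  refine (mul_le_mul_right h2 _).trans ?_
  rw [← ENNReal.ofReal_mul (Real.exp_pos _).le, ENNReal.ofReal_le_one]
  calc Real.exp r * (1 - p / 2) ≤ Real.exp (p / 2) * Real.exp (-(p / 2)) := by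
        have := Real.add_one_le_exp (-(p / 2))
        exact mul_le_mul (Real.exp_le_exp.2 hr) (by linarith) (by linarith) (Real.exp_pos _).le
    _ = 1 := by rw [← Real.exp_add]; simp

/-- The deterministic core: if the projections on a fine net are balanced and of controlled size,
then no open half-space contains all the points. -/
theorem exists_inner_nonpos_of_net (w : ℕ → EuclideanSpace ℝ (Fin n)) {N : ℕ} (hn : 0 < n)
    (hN : 3 ≤ N) {C q ε : ℝ} (hC : 0 < C) (hq : 0 < q) (hε : ε ≤ 1 / 2)
    (hCq : 16 * C * ε ^ 2 ≤ q)
    {s : Set (EuclideanSpace ℝ (Fin n))}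
    (hnet : ∀ x : EuclideanSpace ℝ (Fin n), ‖x‖ = 1 → ∃ y ∈ s, ‖x - y‖ ≤ ε)
    (henergy : ∀ y ∈ s, ∑ i ∈ Finset.range (N + 1), inner ℝ (w i) y ^ 2 ≤ C * (N + 1) / n)
    (hneg : ∀ y ∈ s, ∑ i ∈ Finset.range N,
      ({u : EuclideanSpace ℝ (Fin n) | |inner ℝ u y| ≤ 2 * Real.sqrt C / Real.sqrt n}.indicator
        (fun _ => q) (w i) +
      {v : EuclideanSpace ℝ (Fin n) | inner ℝ v y < -(1 / Real.sqrt n)}.indicator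
        (fun _ => (-1 : ℝ)) (w (i + 1))) < q / 4 * (N + 1))
    {x : EuclideanSpace ℝ (Fin n)} (hx : ‖x‖ = 1) :
    ∃ i < N + 1, inner ℝ (w i) x ≤ 0 := by
  by_contra! hpos
  obtain ⟨y, hy, hxy⟩ := hnet x hx
  have hn0 : (0 : ℝ) < n := by exact_mod_cast hn
  have hsn : 0 < Real.sqrt n := Real.sqrt_pos.2 hn0
  have hN3 : (3 : ℝ) ≤ N := by exact_mod_cast hN
  -- The fine net is also a 1/2-net, so the energy bound extends to every vector, in particular to
  -- `x - y`, where it gains ε².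
  have hdiff := sum_inner_sq_le_of_net w (N + 1) (M := C * (N + 1) / n) (by positivity)
    (fun x hx => (hnet x hx).imp fun y hy => ⟨hy.1, hy.2.trans hε⟩) henergy (x - y)
  have hz : ‖x - y‖ ^ 2 ≤ ε ^ 2 := by gcongr
  -- A point positive on `x` but below -1/√n on `y` contributes at least 1/n to the energy of `x -
  -- y`.
  have hF : ∀ i ∈ Finset.range N, -(n * inner ℝ (w (i + 1)) (x - y) ^ 2) ≤
      {v : EuclideanSpace ℝ (Fin n) | inner ℝ v y < -(1 / Real.sqrt n)}.indicator
        (fun _ => (-1 : ℝ)) (w (i + 1)) := by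
    intro i hi
    by_cases hv : inner ℝ (w (i + 1)) y < -(1 / Real.sqrt n)
    · rw [Set.indicator_of_mem (s := {v | inner ℝ v y < -(1 / Real.sqrt n)}) hv]
      have h1 := hpos (i + 1) (by have := Finset.mem_range.1 hi; omega)
      have h2 : 1 / Real.sqrt n ≤ inner ℝ (w (i + 1)) (x - y) := by
        rw [inner_sub_right]; linarith
      have h3 : (1 / Real.sqrt n) ^ 2 ≤ inner ℝ (w (i + 1)) (x - y) ^ 2 := by gcongr
      rw [div_pow, Real.sq_sqrt hn0.le, one_pow, div_le_iff₀ hn0] at h3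
      linarith
    · rw [Set.indicator_of_notMem (s := {v | inner ℝ v y < -(1 / Real.sqrt n)}) hv]
      have := mul_nonneg hn0.le (sq_nonneg (inner ℝ (w (i + 1)) (x - y)))
      linarith
  -- Markov's inequality in pointwise form: with threshold 2√C/√n, at most a quarter of N + 1 times
  -- are excluded.
  have hH : ∀ i ∈ Finset.range N, q - q * n / (4 * C) * inner ℝ (w i) y ^ 2 ≤
      {u : EuclideanSpace ℝ (Fin n) | |inner ℝ u y| ≤ 2 * Real.sqrt C / Real.sqrt n}.indicator
        (fun _ => q) (w i) := by
    intro i _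
    have h0 : 0 ≤ q * n / (4 * C) * inner ℝ (w i) y ^ 2 := by positivity
    by_cases hu : |inner ℝ (w i) y| ≤ 2 * Real.sqrt C / Real.sqrt n
    · rw [Set.indicator_of_mem (s := {u | |inner ℝ u y| ≤ 2 * Real.sqrt C / Real.sqrt n}) hu]
      linarith
    · rw [Set.indicator_of_notMem (s := {u | |inner ℝ u y| ≤ 2 * Real.sqrt C / Real.sqrt n}) hu]
      have h3 : (2 * Real.sqrt C / Real.sqrt n) ^ 2 ≤ |inner ℝ (w i) y| ^ 2 := by
        have := (not_le.1 hu).le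
        gcongr
      rw [div_pow, mul_pow, Real.sq_sqrt hn0.le, Real.sq_sqrt hC.le, sq_abs] at h3
      have h4 : q = q * n / (4 * C) * (2 ^ 2 * C / n) := by field_simp; norm_num
      have h5 : q ≤ q * n / (4 * C) * inner ℝ (w i) y ^ 2 := by
        calc q = q * n / (4 * C) * (2 ^ 2 * C / n) := h4
          _ ≤ _ := by gcongr
      linarith
  have hsum := (Finset.sum_le_sum fun i hi => add_le_add (hH i hi) (hF i hi)).trans_lt (hneg y hy)
  rw [Finset.sum_add_distrib, Finset.sum_sub_distrib, Finset.sum_neg_distrib, ← Finset.mul_sum,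
    ← Finset.mul_sum, Finset.sum_const, Finset.card_range, nsmul_eq_mul] at hsum
  have h6 : ∑ i ∈ Finset.range N, inner ℝ (w (i + 1)) (x - y) ^ 2 ≤
      4 * (C * (N + 1) / n) * ε ^ 2 := by
    have h7 := Finset.sum_range_succ' (fun i => inner ℝ (w i) (x - y) ^ 2) N
    have h8 : 4 * (C * (N + 1) / n) * ‖x - y‖ ^ 2 ≤ 4 * (C * (N + 1) / n) * ε ^ 2 := by gcongr
    have := sq_nonneg (inner ℝ (w 0) (x - y))
    linarith
  have h9 : ∑ i ∈ Finset.range N, inner ℝ (w i) y ^ 2 ≤ C * (N + 1) / n := by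
    have h7 := Finset.sum_range_succ (fun i => inner ℝ (w i) y ^ 2) N
    have := sq_nonneg (inner ℝ (w N) y)
    linarith [henergy y hy]
  have h10 : q * n / (4 * C) * ∑ i ∈ Finset.range N, inner ℝ (w i) y ^ 2 ≤ q / 4 * (N + 1) := by
    calc _ ≤ q * n / (4 * C) * (C * (N + 1) / n) := by gcongr
      _ = q / 4 * (N + 1) := by field_simp
  have h11 : n * ∑ i ∈ Finset.range N, inner ℝ (w (i + 1)) (x - y) ^ 2 ≤ q / 4 * (N + 1) := by
    calc _ ≤ n * (4 * (C * (N + 1) / n) * ε ^ 2) := by gcongr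
      _ = 16 * C * ε ^ 2 / 4 * (N + 1) := by field_simp; ring
      _ ≤ q / 4 * (N + 1) := by gcongr
  -- Altogether qN < 3 · (q/4)(N + 1), that is N < 3.
  nlinarith

end Walk

/-! ### Union bound over the net and conclusion -/

theorem exists_forall_isSphereWalk_absorbs {θ : ℝ} (hθ : θ ∈ Set.Ioo 0 (Real.pi / 2)) :
    ∃ (L : ℝ) (n₀ : ℕ), 2 ≤ n₀ ∧ ∀ n : ℕ, n₀ ≤ n →
      ∀ (Ω : Type*) [MeasurableSpace Ω] (P : Measure Ω) [IsProbabilityMeasure P]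
        (W : ℕ → Ω → UnitSphere n), IsSphereWalk θ W P →
        ∀ N : ℕ, L * n ≤ N →
          1 - Real.exp (-n) ≤ P.real {ω | (0 : EuclideanSpace ℝ (Fin n)) ∈
            convexHull ℝ ((fun i => (W i ω : EuclideanSpace ℝ (Fin n))) '' {i | i < N})} := by
  have hc1 : 0 < 1 - Real.cos θ := by
    have h : Real.cos θ < Real.cos 0 :=
      Real.cos_lt_cos_of_nonneg_of_le_pi_div_two le_rfl hθ.2.le hθ.1
    rw [Real.cos_zero] at h
    linarith
  obtain ⟨C, hCdef⟩ : ∃ C, C = 256 / (1 - Real.cos θ) := ⟨_, rfl⟩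
  have hC : 0 < C := by rw [hCdef]; positivity
  obtain ⟨p, hp, n₀, hn₀, hstep⟩ := exists_le_stepLaw hθ
    (K := 2 * Real.sqrt C) (by positivity)
  obtain ⟨q, hqdef⟩ : ∃ q, q = p / 2 := ⟨_, rfl⟩
  have hq : 0 < q := by rw [hqdef]; positivity
  obtain ⟨ε, hε0, hε, hCq⟩ : ∃ ε : ℝ, 0 < ε ∧ ε ≤ 1 / 2 ∧ 16 * C * ε ^ 2 ≤ q := by
    refine ⟨min (1 / 2) (Real.sqrt (q / (16 * C))), by positivity, min_le_left _ _, ?_⟩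
    calc 16 * C * min (1 / 2) (Real.sqrt (q / (16 * C))) ^ 2
        ≤ 16 * C * Real.sqrt (q / (16 * C)) ^ 2 := by gcongr; exact min_le_right _ _
      _ = q := by rw [Real.sq_sqrt (by positivity)]; field_simp
  obtain ⟨D, hDdef⟩ : ∃ D, D = 1 + 2 / ε := ⟨_, rfl⟩
  have hD : 1 < D := by
    have : 0 < 2 / ε := by positivity
    linarith
  have hlogD : 0 < Real.log D := Real.log_pos hD
  -- The 4 supplies the mild size conditions on N. The other terms make the two failure
  -- probabilities, with rates 1 and q/4 per step, each at most D⁻ⁿ e^{-2n}, which beats the Dⁿ net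
  -- points.
  refine ⟨4 + (Real.log D + 2) * (1 + 4 / q), n₀, hn₀, fun n hn Ω _ P _ W hW N' hN' => ?_⟩
  have hn2 : 2 ≤ n := hn₀.trans hn
  have hn2R : (2 : ℝ) ≤ n := by exact_mod_cast hn2
  have hN1 : 4 * (n : ℝ) ≤ N' := by
    refine le_trans (mul_le_mul_of_nonneg_right ?_ (by positivity)) hN'
    have : 0 ≤ (Real.log D + 2) * (1 + 4 / q) := by positivity
    linarith
  have hN2 : (Real.log D + 2) * n ≤ N' := by
    refine le_trans (mul_le_mul_of_nonneg_right ?_ (by positivity)) hN'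
    have : 0 ≤ (Real.log D + 2) * (4 / q) := by positivity
    linarith
  have hN3 : (Real.log D + 2) * n ≤ q / 4 * N' := by
    have h1 : (Real.log D + 2) * (4 / q) * n ≤ N' := by
      refine le_trans (mul_le_mul_of_nonneg_right ?_ (by positivity)) hN'
      linarith
    calc (Real.log D + 2) * n = q / 4 * ((Real.log D + 2) * (4 / q) * n) := by field_simp
      _ ≤ q / 4 * N' := by gcongr
  obtain ⟨N, rfl⟩ : ∃ N, N' = N + 1 := by
    refine Nat.exists_eq_succ_of_ne_zero ?_
    rintro rfl
    simp at hN1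
    linarith
  have hN4 : 4 * n ≤ N + 1 := by exact_mod_cast hN1
  push_cast at hN1 hN2 hN3
  obtain ⟨s, hs1, hnet, hcard⟩ := exists_net_unitSphere (EuclideanSpace ℝ (Fin n)) hε0
  rw [finrank_euclideanSpace_fin, ← hDdef] at hcard
  set G := {ω | (0 : EuclideanSpace ℝ (Fin n)) ∈
    convexHull ℝ ((fun i => (W i ω : EuclideanSpace ℝ (Fin n))) '' {i | i < N + 1})} with hG
  set U : EuclideanSpace ℝ (Fin n) → Set (EuclideanSpace ℝ (Fin n)) := fun y =>
    {u | |inner ℝ u y| ≤ 2 * Real.sqrt C / Real.sqrt n} with hU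
  set V : EuclideanSpace ℝ (Fin n) → Set (EuclideanSpace ℝ (Fin n)) := fun y =>
    {v | inner ℝ v y < -(1 / Real.sqrt n)} with hV
  have hUm : ∀ y, MeasurableSet (U y) := fun y => measurableSet_le (by fun_prop) (by fun_prop)
  have hVm : ∀ y, MeasurableSet (V y) := fun y => measurableSet_lt (by fun_prop) (by fun_prop)
  set B₁ : EuclideanSpace ℝ (Fin n) → Set Ω := fun y =>
    {ω | C * (N + 1) / n < ∑ i ∈ Finset.range (N + 1),
      inner ℝ (W i ω : EuclideanSpace ℝ (Fin n)) y ^ 2} with hB₁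
  set B₂ : EuclideanSpace ℝ (Fin n) → Set Ω := fun y =>
    {ω | q / 4 * (N + 1) ≤ ∑ i ∈ Finset.range N,
      ((U y).indicator (fun _ => q) (W i ω : EuclideanSpace ℝ (Fin n)) +
        (V y).indicator (fun _ => (-1 : ℝ)) (W (i + 1) ω : EuclideanSpace ℝ (Fin n)))} with hB₂
  have hsub : Gᶜ ⊆ ⋃ y ∈ s, (B₁ y ∪ B₂ y) := by
    intro ω hω
    by_contra hcon
    simp only [Set.mem_iUnion, Set.mem_union, not_exists, not_or, hB₁, hB₂, Set.mem_ofPred_eq,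
      not_lt, not_le] at hcon
    obtain ⟨x, hx, hpos⟩ := exists_unit_of_zero_notMem_convexHull (by omega)
      ((Set.finite_lt_nat (N + 1)).image _) hω
    obtain ⟨i, hi, hle⟩ := exists_inner_nonpos_of_net
      (fun i => (W i ω : EuclideanSpace ℝ (Fin n))) (by omega) (by omega) hC hq hε hCq
      (s := (s : Set _)) hnet (fun y hy => (hcon y hy).1) (fun y hy => (hcon y hy).2) hx
    have := hpos _ ⟨i, hi, rfl⟩
    rw [real_inner_comm] at this
    linarith
  have hexp : ∀ t : ℝ, (Real.log D + 2) * n ≤ t → Real.exp (-t) ≤ (D ^ n)⁻¹ * Real.exp (-2 * n) := by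
    intro t ht
    calc Real.exp (-t) ≤ Real.exp (-(n * Real.log D) + -2 * n) := Real.exp_le_exp.2 (by linarith)
      _ = _ := by
        rw [Real.exp_add, Real.exp_neg, Real.exp_nat_mul, Real.exp_log (by linarith)]
  have hb₁ : ∀ y ∈ s, P.real (B₁ y) ≤ (D ^ n)⁻¹ * Real.exp (-2 * n) := fun y hy => by
    have := hW.measureReal_sum_inner_sq_le hn2 hθ (hs1 y hy) (N := N) (by omega)
    rw [← hCdef] at this
    exact this.trans (hexp _ hN2)
  have hb₂ : ∀ y ∈ s, P.real (B₂ y) ≤ (D ^ n)⁻¹ * Real.exp (-2 * n) := fun y hy => by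
    refine (hW.measureReal_le_sum_le hn2
      (F := fun v => (V y).indicator (fun _ => (-1 : ℝ)) (v : EuclideanSpace ℝ (Fin n)))
      (H := fun u => (U y).indicator (fun _ => q) (u : EuclideanSpace ℝ (Fin n)))
      ((measurable_const.indicator (hVm y)).comp measurable_subtype_coe)
      ((measurable_const.indicator (hUm y)).comp measurable_subtype_coe)
      (fun u => ?_) N (q / 4 * (N + 1))).trans (hexp _ hN3)
    have := isProbabilityMeasure_stepLaw hn2 θ u
    -- In `U y` the reward `q` = p/2 is paid for by the chance p of entering `V y`; outside there is
    -- no reward, and the -1 only helps.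
    by_cases hu : (u : EuclideanSpace ℝ (Fin n)) ∈ U y
    · rw [Set.indicator_of_mem hu]
      exact exp_mul_lintegral_exp_neg_indicator_le hp
        (B := {w : UnitSphere n | inner ℝ (w : EuclideanSpace ℝ (Fin n)) y < -(1 / Real.sqrt n)})
        (measurableSet_lt (by fun_prop) (by fun_prop)) (hstep n hn u y (hs1 y hy) hu) hqdef.le
    · rw [Set.indicator_of_notMem hu, Real.exp_zero, ENNReal.ofReal_one, one_mul]
      calc _ ≤ ∫⁻ _, 1 ∂stepLaw θ u := by
            refine lintegral_mono fun v => ?_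
            rw [ENNReal.ofReal_le_one, Real.exp_le_one_iff]
            exact Set.indicator_apply_nonpos fun _ => by norm_num
        _ = 1 := by simp
  have hbad : P.real Gᶜ ≤ Real.exp (-n) := by
    calc P.real Gᶜ ≤ P.real (⋃ y ∈ s, (B₁ y ∪ B₂ y)) := measureReal_mono hsub (measure_ne_top _ _)
      _ ≤ ∑ y ∈ s, P.real (B₁ y ∪ B₂ y) := measureReal_biUnion_finset_le _ _
      _ ≤ ∑ _y ∈ s, 2 * ((D ^ n)⁻¹ * Real.exp (-2 * n)) := by
          refine Finset.sum_le_sum fun y hy => (measureReal_union_le _ _).trans ?_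
          linarith [hb₁ y hy, hb₂ y hy]
      _ ≤ D ^ n * (2 * ((D ^ n)⁻¹ * Real.exp (-2 * n))) := by
          rw [Finset.sum_const, nsmul_eq_mul]
          gcongr
      _ = 2 * Real.exp (-2 * n) := by field_simp
      _ ≤ Real.exp n * Real.exp (-2 * n) := by
          gcongr
          linarith [Real.add_one_le_exp (n : ℝ)]
      _ = Real.exp (-n) := by rw [← Real.exp_add]; congr 1; ring
  have h1 : (1 : ℝ) ≤ P.real G + P.real Gᶜ := by
    have := measureReal_union_le (μ := P) G Gᶜ
    rwa [Set.union_compl_self, probReal_univ] at this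
  linarith

theorem theorem16 (θ : ℝ) (hθ : θ ∈ Set.Ioo 0 (Real.pi / 2)) :
    ∃ (L : ℝ) (n₀ : ℕ), ∀ n : ℕ, n₀ ≤ n →
      ∀ (Ω : Type*) [MeasurableSpace Ω] (P : Measure Ω) [IsProbabilityMeasure P]
        (W : ℕ → Ω → UnitSphere n), IsSphereWalk θ W P →
        (∀ N : ℕ, L * n ≤ N →
          1 - Real.exp (-n) ≤ P.real {ω | (0 : EuclideanSpace ℝ (Fin n)) ∈
            convexHull ℝ ((fun i => (W i ω : EuclideanSpace ℝ (Fin n))) '' {i | i < N})}) ∧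
        (∀ N : ℕ, L * n ≤ N →
          1 - Real.exp (-n) ≤
            P.real {ω | coveringTime (Real.pi / 2) (fun i => W i ω) ≤ (N : ℕ∞)}) ∧
        (∀ (N : ℕ) (ω : Ω),
          (0 : EuclideanSpace ℝ (Fin n)) ∈
              convexHull ℝ ((fun i => (W i ω : EuclideanSpace ℝ (Fin n))) '' {i | i < N}) ↔
            coveringTime (Real.pi / 2) (fun i => W i ω) ≤ (N : ℕ∞)) := by
  obtain ⟨L, n₀, hn₀, hmain⟩ := exists_forall_isSphereWalk_absorbs hθ
  refine ⟨L, n₀, fun n hn Ω _ P _ W hW => ?_⟩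
  have hiff : ∀ (N : ℕ) (ω : Ω), (0 : EuclideanSpace ℝ (Fin n)) ∈
      convexHull ℝ ((fun i => (W i ω : EuclideanSpace ℝ (Fin n))) '' {i | i < N}) ↔
        coveringTime (Real.pi / 2) (fun i => W i ω) ≤ (N : ℕ∞) := fun N ω =>
    zero_mem_convexHull_iff_coveringTime_le (by omega) (fun i => W i ω) N
  refine ⟨hmain n hn Ω P W hW, fun N hN => ?_, hiff⟩
  simp_rw [← hiff]
  exact hmain n hn Ω P W hW N hN
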